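/- Let $M$ be a closed oriented smooth 3-manifold and let $\xi'$ be a smooth positive confoliation on $M$, i.e. a plane field $\xi'=\ker\alpha$ for a nowhere vanishing smooth 1-form $\alpha$ with $\alpha\wedge d\alpha\ge 0$ with respect to the orientation of $M$. Let $$H(\xi')=\{x\in M : (\alpha\wedge d\alpha)_x>0\}$$ be the contact region of $\xi'$ (it does not depend on the choice of $\alpha$), and let $G(\xi')$ be the set of all $x\in M$ for which there is a $C^1$ path $\gamma\colon[0,1]\to M$ (whose velocity is allowed to vanish) with $\gamma'(t)\in\xi'_{\gamma(t)}$ for all $t$, $\gamma(0)=x$ and $\gamma(1)\in H(\xi')$. If $G(\xi')=M$, then $\xi'$ can be $C^\infty$-deformed into a contact structure: there are $\epsilon>0$ and a $C^\infty$ family $\xi_t$, $t\in[0,\epsilon]$, of plane fields on $M$ (smooth jointly in $t$ and in the point of $M$) such that $\xi_0=\xi'$ and, for every $t\in(0,\epsilon]$, $\xi_t$ is a positive contact structure, i.e. $\xi_t=\ker\alpha_t$ for some smooth 1-form $\alpha_t$ with $\alpha_t\wedge d\alpha_t>0$. -/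

import Mathlib

open Set Filter Manifold Bundle
open scoped Topology ContDiff

namespace Confoliation

/-- The model space `ℝ³`. -/
abbrev E3 : Type := EuclideanSpace ℝ (Fin 3)

section Definitions

variable {M : Type*} [TopologicalSpace M] [ChartedSpace E3 M] [IsManifold (𝓡 3) ∞ M]

/-! ### Orientations -/

variable (M) in
/-- An orientation of the 3-manifold `M`: an orientation of every tangent space which, read in
the local trivialisations of the tangent bundle, is locally constant. -/
structure ManifoldOrientation where
  /-- the orientation of the tangent space at each point -/
  orient : ∀ x : M, Orientation ℝ (TangentSpace (𝓡 3) x) (Fin 3)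
  locally_constant : ∀ x₀ : M, ∃ O : Orientation ℝ E3 (Fin 3), ∀ᶠ y in 𝓝 x₀,
    ∃ hy : y ∈ (trivializationAt E3 (TangentSpace (𝓡 3) : M → Type _) x₀).baseSet,
      Orientation.map (Fin 3)
        ((trivializationAt E3 (TangentSpace (𝓡 3) : M → Type _) x₀).continuousLinearEquivAt
          ℝ y hy).toLinearEquiv (orient y) = O

/-! ### 1-forms, the exterior derivative and `α ∧ dα` -/

variable (M) in
/-- A (not necessarily continuous) 1-form on `M`. -/
abbrev OneForm : Type _ := ∀ x : M, TangentSpace (𝓡 3) x →L[ℝ] ℝ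

/-- `α` is a `C^∞` section of the cotangent bundle. -/
def IsSmoothForm (α : OneForm M) : Prop :=
  ContMDiff (𝓡 3) ((𝓡 3).prod 𝓘(ℝ, E3 →L[ℝ] ℝ)) ∞
    (fun x : M => (TotalSpace.mk' (E3 →L[ℝ] ℝ)
      (E := fun x : M => TangentSpace (𝓡 3) x →L[ℝ] Bundle.Trivial M ℝ x) x (α x)))

/-- The 1-form `α` read in the preferred chart at `x₀`: the pull-back of `α` by the inverse of
the chart. -/
noncomputable def formInChart (α : OneForm M) (x₀ : M) (y : E3) : E3 →L[ℝ] ℝ :=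
  (α ((extChartAt (𝓡 3) x₀).symm y)).comp
    (mfderiv 𝓘(ℝ, E3) (𝓡 3) (extChartAt (𝓡 3) x₀).symm y)

/-- The exterior derivative of the 1-form `α` at `x`, computed in the preferred chart at `x` and
evaluated on two tangent vectors. -/
noncomputable def dForm (α : OneForm M) (x : M) (v w : TangentSpace (𝓡 3) x) : ℝ :=
  extDeriv
    (fun y : E3 => ContinuousAlternatingMap.ofSubsingleton ℝ E3 ℝ (0 : Fin 1) (formInChart α x y))
    (extChartAt (𝓡 3) x x)
    ![(mfderiv (𝓡 3) 𝓘(ℝ, E3) (extChartAt (𝓡 3) x) x v : E3),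
      (mfderiv (𝓡 3) 𝓘(ℝ, E3) (extChartAt (𝓡 3) x) x w : E3)]

/-- The 3-form `α ∧ dα` at `x`, evaluated on three tangent vectors. -/
noncomputable def wedgeD (α : OneForm M) (x : M) (u v w : TangentSpace (𝓡 3) x) : ℝ :=
  α x u * dForm α x v w - α x v * dForm α x u w + α x w * dForm α x u v

/-- `(α ∧ dα)_x > 0` with respect to the orientation `o`. -/
def WedgePos (o : ManifoldOrientation M) (α : OneForm M) (x : M) : Prop :=
  ∀ b : Module.Basis (Fin 3) ℝ (TangentSpace (𝓡 3) x), b.orientation = o.orient x →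
    0 < wedgeD α x (b 0) (b 1) (b 2)

/-- `(α ∧ dα)_x ≥ 0` with respect to the orientation `o`. -/
def WedgeNonneg (o : ManifoldOrientation M) (α : OneForm M) (x : M) : Prop :=
  ∀ b : Module.Basis (Fin 3) ℝ (TangentSpace (𝓡 3) x), b.orientation = o.orient x →
    0 ≤ wedgeD α x (b 0) (b 1) (b 2)

/-! ### Plane fields, confoliations, contact structures -/

variable (M) in
/-- A field of linear subspaces of the tangent spaces of `M`. That these are planes varying
smoothly is part of the predicates below, in which the subspaces are kernels of nowhere
vanishing smooth 1-forms. -/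
abbrev PlaneField : Type _ := ∀ x : M, Submodule ℝ (TangentSpace (𝓡 3) x)

/-- `α` is a nowhere vanishing smooth 1-form with `ξ = ker α`. -/
def IsDefiningForm (ξ : PlaneField M) (α : OneForm M) : Prop :=
  IsSmoothForm α ∧ ∀ x, α x ≠ 0 ∧ ∀ v, v ∈ ξ x ↔ α x v = 0

/-- `ξ` is a (smooth) positive confoliation: `ξ = ker α` with `α ∧ dα ≥ 0`. -/
def IsConfoliation (o : ManifoldOrientation M) (ξ : PlaneField M) : Prop :=
  ∃ α, IsDefiningForm ξ α ∧ ∀ x, WedgeNonneg o α x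

/-- `ξ` is a (smooth) positive contact structure: `ξ = ker α` with `α ∧ dα > 0`. -/
def IsContact (o : ManifoldOrientation M) (ξ : PlaneField M) : Prop :=
  ∃ α, IsDefiningForm ξ α ∧ ∀ x, WedgePos o α x

/-- The contact region (hot zone) `H(ξ)`: the points at which `ξ` is positively contact. -/
def hotZone (o : ManifoldOrientation M) (ξ : PlaneField M) : Set M :=
  {x | ∃ α, IsDefiningForm ξ α ∧ WedgePos o α x}

/-- `γ`, restricted to `[0,1]`, is a `C^1` path tangent to `ξ`. The velocity may vanish. -/
def IsTangentPath (ξ : PlaneField M) (γ : ℝ → M) : Prop :=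
  ContMDiffOn 𝓘(ℝ, ℝ) (𝓡 3) 1 γ (Icc 0 1) ∧
    ∀ t ∈ Icc (0 : ℝ) 1,
      mfderivWithin 𝓘(ℝ, ℝ) (𝓡 3) γ (Icc 0 1) t (1 : ℝ) ∈ ξ (γ t)

/-- The set `G(ξ)` of the points joined to the contact region by a path tangent to `ξ`. -/
def accessibleSet (o : ManifoldOrientation M) (ξ : PlaneField M) : Set M :=
  {x | ∃ γ : ℝ → M, IsTangentPath ξ γ ∧ γ 0 = x ∧ γ 1 ∈ hotZone o ξ}

/-- `ξ t`, `t ∈ [0, ε]`, is a `C^∞` family of plane fields: near every point of `[0, ε] × M` it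
is the kernel of a nowhere vanishing 1-form depending smoothly on the parameter and the point
jointly, up to the ends of the parameter interval. -/
def IsSmoothFamily (ε : ℝ) (ξ : ℝ → PlaneField M) : Prop :=
  ∀ t₀ ∈ Icc (0 : ℝ) ε, ∀ x₀ : M, ∃ U ∈ 𝓝 (t₀, x₀), ∃ β : ℝ → OneForm M,
    ContMDiffOn (𝓘(ℝ, ℝ).prod (𝓡 3)) ((𝓡 3).prod 𝓘(ℝ, E3 →L[ℝ] ℝ)) ∞
      (fun p : ℝ × M => (TotalSpace.mk' (E3 →L[ℝ] ℝ)
        (E := fun x : M => TangentSpace (𝓡 3) x →L[ℝ] Bundle.Trivial M ℝ x) p.2 (β p.1 p.2)))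
      (U ∩ Icc (0 : ℝ) ε ×ˢ (univ : Set M)) ∧
    ∀ p ∈ U ∩ Icc (0 : ℝ) ε ×ˢ (univ : Set M),
      β p.1 p.2 ≠ 0 ∧ ∀ v, v ∈ ξ p.1 p.2 ↔ β p.1 p.2 v = 0

/-- `ξ` can be `C^∞`-deformed into a positive contact structure. -/
def CanBeDeformedToContact (o : ManifoldOrientation M) (ξ : PlaneField M) : Prop :=
  ∃ ε : ℝ, 0 < ε ∧ ∃ ζ : ℝ → PlaneField M,
    IsSmoothFamily ε ζ ∧ ζ 0 = ξ ∧ ∀ t ∈ Ioc (0 : ℝ) ε, IsContact o (ζ t)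

end Definitions

end Confoliation

/-! The deformation is affine: `α + tβ` for a single smooth form `β`. Its wedge with its
differential is `α ∧ dα + t(α ∧ dβ + β ∧ dα) + t²(β ∧ dβ)`. Since `α ∧ dα ≥ 0` and `M` is compact,
it suffices that the linear term be positive wherever `α ∧ dα` is not
(`canBeDeformedToContact_of_linPos`). This condition is linear in `β`, so solutions can be added.
Call `β` admissible if the linear term is nonnegative at all non-contact points, and call a point
good if it is contact or some admissible `β` is strictly positive there. Good points form an open
set, and if all points are good, a finite sum of admissible forms solves the problem
(`exists_admissible_of_isCompact`).

It remains to exclude bad points. This is a propagation argument in the style of Bony's maximum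
principle. If a ball of good points touches the bad set at `p`, its normal there is proportional to
`α` (`det3_eq_zero_of_notMem_goodSet`). Otherwise `exp(-1/g) c`, with `g` a quadratic barrier and
`c` a suitable constant covector, has positive linear term near `p`, because the term `α ∧ dg ∧ c`
carries the dominating factor `g⁻²`. The cutoff spoils this only inside the good ball, where a large
multiple of an admissible form repairs it (`mem_goodSet_of_chart`).

A path tangent to `ξ` is thus almost orthogonal to the normals of the bad set, up to an error linear
in the distance, and Grönwall applied to the squared distance keeps it in the bad set
(`mem_of_inner_normal_le`, `IsTangentPath.eventually_notMem_goodSet`). A path from a bad point could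
then never reach the contact region, contrary to accessibility. -/

namespace Confoliation

/-! ### Reading 1-forms and their differentials in a fixed chart -/

section Chart

/-- The exterior derivative of a 1-form on `ℝ³`, evaluated on two vectors. -/
noncomputable def curl (A : E3 → E3 →L[ℝ] ℝ) (y v w : E3) : ℝ :=
  fderiv ℝ A y v w - fderiv ℝ A y w v

theorem extDeriv_ofSubsingleton_apply {A : E3 → E3 →L[ℝ] ℝ} {y : E3}
    (hA : DifferentiableAt ℝ A y) (v w : E3) :
    extDeriv (fun y : E3 => ContinuousAlternatingMap.ofSubsingleton ℝ E3 ℝ (0 : Fin 1) (A y)) y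
      ![v, w] = curl A y v w := by
  have hd : DifferentiableAt ℝ
      (fun y : E3 => ContinuousAlternatingMap.ofSubsingleton ℝ E3 ℝ (0 : Fin 1) (A y)) y :=
    ((ContinuousAlternatingMap.ofSubsingletonLIE (𝕜 := ℝ) (E := E3) (F := ℝ)
      (0 : Fin 1)).toContinuousLinearEquiv.toContinuousLinearMap.differentiableAt).comp y hA
  have key : ∀ u w : E3, fderiv ℝ (fun z => A z u) y w = fderiv ℝ A y w u := by
    intro u w
    rw [fderiv_clm_apply hA (differentiableAt_const u)]
    simp
  rw [extDeriv_apply hd]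
  simp [Fin.sum_univ_two, Fin.removeNth, curl, key, sub_eq_add_neg]

variable {M : Type*} [TopologicalSpace M] [ChartedSpace E3 M]

/-- All tangent spaces unfold to `E3`, so the same `v` is used at both base points; this moves along
equalities such as `left_inv` of a chart without casts. -/
theorem oneForm_congr (α : OneForm M) {x z : M} (h : z = x) (v : E3) : α z v = α x v := by
  subst h; rfl

variable [IsManifold (𝓡 3) ∞ M]

/-- The trivialization of the cotangent bundle at `x₀` reads a 1-form in the chart at `x₀`. -/
theorem trivializationAt_form_snd (α : OneForm M) {x₀ x : M}
    (hx : x ∈ (chartAt E3 x₀).source) :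
    (trivializationAt (E3 →L[ℝ] ℝ)
      (fun x : M => TangentSpace (𝓡 3) x →L[ℝ] Bundle.Trivial M ℝ x) x₀
        (TotalSpace.mk' (E3 →L[ℝ] ℝ) x (α x))).2 = formInChart α x₀ (extChartAt (𝓡 3) x₀ x) := by
  have hx' : x ∈ (extChartAt (𝓡 3) x₀).source := by rwa [extChartAt_source]
  have h1 := TangentBundle.symmL_trivializationAt (I := 𝓡 3) (𝕜 := ℝ) hx
  rw [ModelWithCorners.range_eq_univ, mfderivWithin_univ] at h1
  rw [hom_trivializationAt_apply]
  ext v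
  unfold ContinuousLinearMap.inCoordinates formInChart
  rw [h1]
  simp
  exact (oneForm_congr α ((extChartAt (𝓡 3) x₀).left_inv hx') _).symm

theorem contMDiffAt_form_iff (α : OneForm M) {x₀ x : M} (hx : x ∈ (chartAt E3 x₀).source) :
    ContMDiffAt (𝓡 3) ((𝓡 3).prod 𝓘(ℝ, E3 →L[ℝ] ℝ)) ∞
      (fun x : M => (TotalSpace.mk' (E3 →L[ℝ] ℝ)
        (E := fun x : M => TangentSpace (𝓡 3) x →L[ℝ] Bundle.Trivial M ℝ x) x (α x))) x ↔
    ContMDiffAt (𝓡 3) 𝓘(ℝ, E3 →L[ℝ] ℝ) ∞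
      (fun x => formInChart α x₀ (extChartAt (𝓡 3) x₀ x)) x := by
  rw [Trivialization.contMDiffAt_section_iff (IB := 𝓡 3) (n := ∞) (trivializationAt (E3 →L[ℝ] ℝ)
      (fun x : M => TangentSpace (𝓡 3) x →L[ℝ] Bundle.Trivial M ℝ x) x₀)
      (by simpa using hx)]
  apply Filter.EventuallyEq.contMDiffAt_iff
  filter_upwards [(chartAt E3 x₀).open_source.mem_nhds hx] with z hz
  exact trivializationAt_form_snd α hz

theorem IsSmoothForm.contDiffAt {α : OneForm M} (hα : IsSmoothForm α) {x₀ : M} {y : E3}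
    (hy : y ∈ (extChartAt (𝓡 3) x₀).target) : ContDiffAt ℝ ∞ (formInChart α x₀) y := by
  have hs : (extChartAt (𝓡 3) x₀).symm y ∈ (chartAt E3 x₀).source := by
    rw [← extChartAt_source (𝓡 3)]; exact (extChartAt (𝓡 3) x₀).map_target hy
  have h1 := (contMDiffAt_form_iff α hs).1 (hα _)
  have h2 : ContMDiffAt 𝓘(ℝ, E3) (𝓡 3) ∞ (extChartAt (𝓡 3) x₀).symm y :=
    (contMDiffOn_extChartAt_symm x₀).contMDiffAt (extChartAt_target_mem_nhds' hy)
  have h3 := h1.comp y h2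
  rw [contMDiffAt_iff_contDiffAt] at h3
  refine h3.congr_of_eventuallyEq ?_
  filter_upwards [extChartAt_target_mem_nhds' (I := 𝓡 3) hy] with z hz
  simp only [Function.comp_apply, (extChartAt (𝓡 3) x₀).right_inv hz]

theorem contMDiffAt_of_formInChart {α : OneForm M} {x₀ x : M} (hx : x ∈ (chartAt E3 x₀).source)
    (h : ContDiffAt ℝ ∞ (formInChart α x₀) (extChartAt (𝓡 3) x₀ x)) :
    ContMDiffAt (𝓡 3) ((𝓡 3).prod 𝓘(ℝ, E3 →L[ℝ] ℝ)) ∞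
      (fun x : M => (TotalSpace.mk' (E3 →L[ℝ] ℝ)
        (E := fun x : M => TangentSpace (𝓡 3) x →L[ℝ] Bundle.Trivial M ℝ x) x (α x))) x :=
  (contMDiffAt_form_iff α hx).2
    (h.contMDiffAt.comp x (contMDiffAt_extChartAt' (by simpa using hx)))

/-- The derivative at `x` of the preferred chart at `x₀`. -/
noncomputable def chartDeriv (x₀ x : M) : E3 →L[ℝ] E3 :=
  (mfderiv (𝓡 3) 𝓘(ℝ, E3) (extChartAt (𝓡 3) x₀) x :)

theorem formInChart_chartDeriv (α : OneForm M) {x₀ x : M} (hx : x ∈ (chartAt E3 x₀).source)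
    (v : E3) : formInChart α x₀ (extChartAt (𝓡 3) x₀ x) (chartDeriv x₀ x v) = α x v := by
  have hx' : x ∈ (extChartAt (𝓡 3) x₀).source := by rwa [extChartAt_source]
  have h := mfderivWithin_extChartAt_symm_comp_mfderiv_extChartAt' (I := 𝓡 3) hx'
  rw [ModelWithCorners.range_eq_univ, mfderivWithin_univ] at h
  have h' : mfderiv 𝓘(ℝ, E3) (𝓡 3) (extChartAt (𝓡 3) x₀).symm (extChartAt (𝓡 3) x₀ x)
    (chartDeriv x₀ x v) = v := DFunLike.congr_fun h v
  refine Eq.trans ?_ (oneForm_congr α ((extChartAt (𝓡 3) x₀).left_inv hx') v)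
  exact congrArg (α ((extChartAt (𝓡 3) x₀).symm (extChartAt (𝓡 3) x₀ x))) h'

/-- Naturality of `d` under the transition map `τ` between the charts at `x` and `x₀`. The
definition of `dForm` switches charts with the point; only after this can it be studied as a
function of the point. -/
theorem dForm_eq_curl {α : OneForm M} (hα : IsSmoothForm α) {x₀ x : M}
    (hx : x ∈ (chartAt E3 x₀).source) (v w : E3) :
    dForm α x v w = curl (formInChart α x₀) (extChartAt (𝓡 3) x₀ x)
      (chartDeriv x₀ x v) (chartDeriv x₀ x w) := by
  set τ : E3 → E3 := extChartAt (𝓡 3) x₀ ∘ (extChartAt (𝓡 3) x).symm with hτ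
  set y := extChartAt (𝓡 3) x x with hy
  have hyt : y ∈ (extChartAt (𝓡 3) x).target := mem_extChartAt_target x
  have hxy : (extChartAt (𝓡 3) x).symm y = x := extChartAt_to_inv x
  have hτy : τ y = extChartAt (𝓡 3) x₀ x := by simp only [hτ, Function.comp_apply, hxy]
  have hnear : ∀ᶠ z in 𝓝 y, z ∈ (extChartAt (𝓡 3) x).target ∧
      (extChartAt (𝓡 3) x).symm z ∈ (chartAt E3 x₀).source := by
    refine Filter.Eventually.and (extChartAt_target_mem_nhds (I := 𝓡 3) x) ?_
    apply (continuousAt_extChartAt_symm (I := 𝓡 3) x).eventually_mem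
    rw [← hy, hxy]
    exact (chartAt E3 x₀).open_source.mem_nhds hx
  have hsymm : ∀ z ∈ (extChartAt (𝓡 3) x).target,
      ContMDiffAt 𝓘(ℝ, E3) (𝓡 3) ∞ (extChartAt (𝓡 3) x).symm z := fun z hz =>
    (contMDiffOn_extChartAt_symm x).contMDiffAt (extChartAt_target_mem_nhds' hz)
  have hτd : ContDiffAt ℝ ∞ τ y := by
    rw [← contMDiffAt_iff_contDiffAt]
    refine ContMDiffAt.comp y ?_ (hsymm y hyt)
    rw [hxy]
    exact contMDiffAt_extChartAt' hx
  have hpull : ∀ᶠ z in 𝓝 y, formInChart α x z =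
      (formInChart α x₀ (τ z)).comp (fderiv ℝ τ z) := by
    filter_upwards [hnear] with z hz
    have h1 : fderiv ℝ τ z = (chartDeriv x₀ ((extChartAt (𝓡 3) x).symm z)).comp
        (mfderiv 𝓘(ℝ, E3) (𝓡 3) (extChartAt (𝓡 3) x).symm z : E3 →L[ℝ] E3) := by
      rw [← mfderiv_eq_fderiv, hτ]
      exact mfderiv_comp z (mdifferentiableAt_extChartAt hz.2)
        ((hsymm z hz.1).mdifferentiableAt (by simp))
    rw [h1]
    ext v
    exact (formInChart_chartDeriv α hz.2 _).symm
  have hA : DifferentiableAt ℝ (formInChart α x₀) (τ y) := by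
    rw [hτy]
    exact (hα.contDiffAt ((extChartAt (𝓡 3) x₀).map_source (by simpa using hx))).differentiableAt
      (by simp)
  have hd : DifferentiableAt ℝ
      (fun y : E3 => ContinuousAlternatingMap.ofSubsingleton ℝ E3 ℝ (0 : Fin 1)
        (formInChart α x₀ y)) (τ y) :=
    ((ContinuousAlternatingMap.ofSubsingletonLIE (𝕜 := ℝ) (E := E3) (F := ℝ)
      (0 : Fin 1)).toContinuousLinearEquiv.toContinuousLinearMap.differentiableAt).comp (τ y) hA
  have hchain : ∀ u : E3, fderiv ℝ τ y (chartDeriv x x u) = chartDeriv x₀ x u := by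
    intro u
    have h1 : mfderiv 𝓘(ℝ, E3) 𝓘(ℝ, E3) τ y =
        (mfderiv (𝓡 3) 𝓘(ℝ, E3) (extChartAt (𝓡 3) x₀) ((extChartAt (𝓡 3) x).symm y)).comp
        (mfderiv 𝓘(ℝ, E3) (𝓡 3) (extChartAt (𝓡 3) x).symm y) := by
      rw [hτ]
      exact mfderiv_comp y (mdifferentiableAt_extChartAt (by rwa [hxy]))
        ((hsymm y hyt).mdifferentiableAt (by simp))
    have h2 := mfderivWithin_extChartAt_symm_comp_mfderiv_extChartAt' (I := 𝓡 3)
      (mem_extChartAt_source (I := 𝓡 3) x)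
    rw [ModelWithCorners.range_eq_univ, mfderivWithin_univ] at h2
    have h2' : mfderiv 𝓘(ℝ, E3) (𝓡 3) (extChartAt (𝓡 3) x).symm y (chartDeriv x x u) = u :=
      DFunLike.congr_fun h2 u
    have h3 : ∀ z, z = x → ∀ u : E3, chartDeriv x₀ z u = chartDeriv x₀ x u := by
      rintro z rfl u; rfl
    rw [← mfderiv_eq_fderiv, h1]
    refine Eq.trans ?_ (h3 _ hxy u)
    exact congrArg (chartDeriv x₀ ((extChartAt (𝓡 3) x).symm y)) h2'
  have hev : (fun z : E3 => ContinuousAlternatingMap.ofSubsingleton ℝ E3 ℝ (0 : Fin 1)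
      (formInChart α x z)) =ᶠ[𝓝 y] fun z =>
      (ContinuousAlternatingMap.ofSubsingleton ℝ E3 ℝ (0 : Fin 1)
        (formInChart α x₀ (τ z))).compContinuousLinearMap (fderiv ℝ τ z) := by
    filter_upwards [hpull] with z hz
    rw [hz]; ext v; simp
  have hvec : (fderiv ℝ τ y : E3 → E3) ∘ ![chartDeriv x x v, chartDeriv x x w]
      = ![chartDeriv x₀ x v, chartDeriv x₀ x w] := by
    ext i : 1
    fin_cases i
    · exact hchain v
    · exact hchain w
  have h0 : dForm α x v w = extDeriv (fun z : E3 =>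
      ContinuousAlternatingMap.ofSubsingleton ℝ E3 ℝ (0 : Fin 1) (formInChart α x z)) y
      ![chartDeriv x x v, chartDeriv x x w] := rfl
  rw [h0, hev.extDeriv_eq, extDeriv_pullback (r := (2 : ℕ)) hd (contDiffAt_infty.1 hτd 2) (by simp),
    ContinuousAlternatingMap.compContinuousLinearMap_apply, hvec,
    extDeriv_ofSubsingleton_apply hA, hτy]

end Chart

/-! ### Densities of 3-forms on `ℝ³` and the linearization of `A ∧ dA` -/

/-- The standard basis of `ℝ³`. -/
noncomputable def stdBasis : Module.Basis (Fin 3) ℝ E3 := (EuclideanSpace.basisFun (Fin 3) ℝ).toBasis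

/-- The 3-form `A ∧ dB` on `ℝ³`, evaluated on three vectors. -/
noncomputable def wedge3 (A B : E3 → E3 →L[ℝ] ℝ) (y u v w : E3) : ℝ :=
  A y u * curl B y v w - A y v * curl B y u w + A y w * curl B y u v

/-- The density of the 3-form `A ∧ dB` on `ℝ³`. -/
noncomputable def density (A B : E3 → E3 →L[ℝ] ℝ) (y : E3) : ℝ :=
  wedge3 A B y (stdBasis 0) (stdBasis 1) (stdBasis 2)

/-- The density of the 3-form `a ∧ b ∧ c` on `ℝ³` for covectors `a`, `b`, `c`. -/
noncomputable def det3 (a b c : E3 →L[ℝ] ℝ) : ℝ :=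
  a (stdBasis 0) * (b (stdBasis 1) * c (stdBasis 2) - b (stdBasis 2) * c (stdBasis 1))
  - a (stdBasis 1) * (b (stdBasis 0) * c (stdBasis 2) - b (stdBasis 2) * c (stdBasis 0))
  + a (stdBasis 2) * (b (stdBasis 0) * c (stdBasis 1) - b (stdBasis 1) * c (stdBasis 0))

theorem eq_sum_stdBasis (u : E3) :
    u = u 0 • stdBasis 0 + u 1 • stdBasis 1 + u 2 • stdBasis 2 := by
  ext i
  fin_cases i <;> simp [stdBasis]

/-- Alternating 3-forms on `ℝ³` are multiples of the determinant. This turns positivity on oriented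
bases into the sign of one real function. -/
theorem wedge3_eq_det_mul (A B : E3 → E3 →L[ℝ] ℝ) (y : E3) (b : Fin 3 → E3) :
    wedge3 A B y (b 0) (b 1) (b 2) = stdBasis.det b * density A B y := by
  have hdet : stdBasis.det b = (b 0) 0 * (b 1) 1 * (b 2) 2 - (b 0) 0 * (b 1) 2 * (b 2) 1
      - (b 0) 1 * (b 1) 0 * (b 2) 2 + (b 0) 1 * (b 1) 2 * (b 2) 0
      + (b 0) 2 * (b 1) 0 * (b 2) 1 - (b 0) 2 * (b 1) 1 * (b 2) 0 := by
    rw [Module.Basis.det_apply, Matrix.det_fin_three]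
    simp only [Module.Basis.toMatrix_apply, stdBasis, OrthonormalBasis.coe_toBasis_repr_apply,
      EuclideanSpace.basisFun_repr]
    ring
  rw [hdet]
  generalize b 0 = u
  generalize b 1 = v
  generalize b 2 = w
  have hA : ∀ x : E3, A y x = x 0 * A y (stdBasis 0) + x 1 * A y (stdBasis 1)
      + x 2 * A y (stdBasis 2) := by
    intro x
    conv_lhs => rw [eq_sum_stdBasis x]
    simp
  have hB : ∀ x z : E3, fderiv ℝ B y x z =
      x 0 * (z 0 * fderiv ℝ B y (stdBasis 0) (stdBasis 0) + z 1 * fderiv ℝ B y (stdBasis 0) (stdBasis 1)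
        + z 2 * fderiv ℝ B y (stdBasis 0) (stdBasis 2))
      + x 1 * (z 0 * fderiv ℝ B y (stdBasis 1) (stdBasis 0) + z 1 * fderiv ℝ B y (stdBasis 1) (stdBasis 1)
        + z 2 * fderiv ℝ B y (stdBasis 1) (stdBasis 2))
      + x 2 * (z 0 * fderiv ℝ B y (stdBasis 2) (stdBasis 0) + z 1 * fderiv ℝ B y (stdBasis 2) (stdBasis 1)
        + z 2 * fderiv ℝ B y (stdBasis 2) (stdBasis 2)) := by
    intro x z
    conv_lhs => rw [eq_sum_stdBasis x, eq_sum_stdBasis z]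
    simp
  simp only [density, wedge3, curl]
  rw [hA u, hA v, hA w, hB u v, hB v u, hB u w, hB w u, hB v w, hB w v]
  ring

section Density

variable {A B C : E3 → E3 →L[ℝ] ℝ} {y : E3}

theorem continuousAt_density (hA : ContDiffAt ℝ 1 A y) (hB : ContDiffAt ℝ 1 B y) :
    ContinuousAt (density A B) y := by
  have h1 : ∀ v, ContinuousAt (fun z => A z v) y := fun v =>
    hA.continuousAt.clm_apply continuousAt_const
  have h2 : ContinuousAt (fderiv ℝ B) y := hB.continuousAt_fderiv (by simp)
  have h3 : ∀ v w, ContinuousAt (fun z => fderiv ℝ B z v w) y := fun v w =>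
    (h2.clm_apply continuousAt_const).clm_apply continuousAt_const
  unfold density wedge3 curl
  exact (((h1 _).mul ((h3 _ _).sub (h3 _ _))).sub ((h1 _).mul ((h3 _ _).sub (h3 _ _)))).add
    ((h1 _).mul ((h3 _ _).sub (h3 _ _)))

theorem density_add_left : density (A + B) C y = density A C y + density B C y := by
  simp only [density, wedge3, Pi.add_apply, add_apply]
  ring

theorem density_smul_left (t : ℝ) : density (t • A) C y = t * density A C y := by
  simp only [density, wedge3, Pi.smul_apply, smul_apply, smul_eq_mul]
  ring

theorem density_add_right (hB : DifferentiableAt ℝ B y) (hC : DifferentiableAt ℝ C y) :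
    density A (B + C) y = density A B y + density A C y := by
  simp only [density, wedge3, curl, fderiv_add hB hC, add_apply]
  ring

theorem density_smul_right (t : ℝ) : density A (t • C) y = t * density A C y := by
  have h : fderiv ℝ (t • C) y = t • fderiv ℝ C y := by
    exact congrFun (fderiv_const_smul_field (𝕜 := ℝ) (E := E3) (F := E3 →L[ℝ] ℝ) (R := ℝ)
      (f := C) t) y
  simp only [density, wedge3, curl, h, smul_apply, smul_eq_mul]
  ring

/-- The Leibniz rule `d(fB) = df ∧ B + f dB`. -/
theorem density_fun_smul_right {f : E3 → ℝ} (hf : DifferentiableAt ℝ f y)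
    (hB : DifferentiableAt ℝ B y) :
    density A (fun z => f z • B z) y = f y * density A B y + det3 (A y) (fderiv ℝ f y) (B y) := by
  have h : fderiv ℝ (fun z => f z • B z) y = f y • fderiv ℝ B y + (fderiv ℝ f y).smulRight (B y) :=
    fderiv_fun_smul hf hB
  simp only [density, wedge3, curl, det3, h, add_apply,
    smul_apply, ContinuousLinearMap.smulRight_apply, smul_eq_mul]
  ring

theorem density_fun_smul_left {f : E3 → ℝ} :
    density (fun z => f z • A z) B y = f y * density A B y := by
  simp only [density, wedge3, smul_apply, smul_eq_mul]
  ring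

theorem density_congr {A' B' : E3 → E3 →L[ℝ] ℝ} (hA : A y = A' y) (hB : B =ᶠ[𝓝 y] B') :
    density A B y = density A' B' y := by
  simp only [density, wedge3, curl, hA, hB.fderiv_eq]

theorem det3_self_right (a b : E3 →L[ℝ] ℝ) : det3 a b a = 0 := by
  unfold det3; ring

theorem density_const (c : E3 →L[ℝ] ℝ) : density A (fun _ => c) y = 0 := by
  simp [density, wedge3, curl]

/-- The density of the linearization `A ∧ dB + B ∧ dA` of `A ∧ dA` in the direction `B`. -/
noncomputable def linDensity (A B : E3 → E3 →L[ℝ] ℝ) (y : E3) : ℝ :=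
  density A B y + density B A y

theorem linDensity_add (hB : DifferentiableAt ℝ B y) (hC : DifferentiableAt ℝ C y) :
    linDensity A (B + C) y = linDensity A B y + linDensity A C y := by
  simp only [linDensity, density_add_right hB hC, density_add_left]
  ring

theorem linDensity_smul (t : ℝ) : linDensity A (t • B) y = t * linDensity A B y := by
  simp only [linDensity, density_smul_right, density_smul_left]
  ring

theorem density_add_smul (hA : DifferentiableAt ℝ A y) (hB : DifferentiableAt ℝ B y) (t : ℝ) :
    density (A + t • B) (A + t • B) y =
      density A A y + t * linDensity A B y + t ^ 2 * density B B y := by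
  rw [density_add_left, density_add_right hA (hB.const_smul t),
    density_add_right hA (hB.const_smul t)]
  simp only [linDensity, density_smul_right, density_smul_left]
  ring

/-- As `dc = 0`, only one term of order zero in `f` survives beside `A ∧ df ∧ c`. A function with
large logarithmic derivative therefore lets the second term decide the sign. -/
theorem linDensity_smul_const {f : E3 → ℝ} (hf : DifferentiableAt ℝ f y) (c : E3 →L[ℝ] ℝ) :
    linDensity A (fun z => f z • c) y =
      f y * density (fun _ => c) A y + det3 (A y) (fderiv ℝ f y) c := by
  rw [linDensity, density_fun_smul_right hf (differentiableAt_const c), density_const,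
    density_fun_smul_left]
  ring

theorem linDensity_congr {B' : E3 → E3 →L[ℝ] ℝ} (hB : B =ᶠ[𝓝 y] B') :
    linDensity A B y = linDensity A B' y := by
  rw [linDensity, linDensity, density_congr rfl hB, density_congr hB.eq_of_nhds EventuallyEq.rfl]

end Density

/-! ### Orientation and positivity in charts -/

section Sign

variable {M : Type*} [TopologicalSpace M] [ChartedSpace E3 M] [IsManifold (𝓡 3) ∞ M]

theorem exists_chart_sign (o : ManifoldOrientation M) (x₀ : M) :
    ∃ σ : ℝ, σ ≠ 0 ∧ ∀ᶠ x in 𝓝 x₀, x ∈ (chartAt E3 x₀).source ∧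
      ∀ b : Module.Basis (Fin 3) ℝ (TangentSpace (𝓡 3) x), b.orientation = o.orient x →
        0 < σ * stdBasis.det (fun i => chartDeriv x₀ x (b i)) := by
  obtain ⟨O, hO⟩ := o.locally_constant x₀
  have key : ∃ σ : ℝ, σ ≠ 0 ∧ ∀ b : Module.Basis (Fin 3) ℝ E3, b.orientation = O →
      0 < σ * stdBasis.det b := by
    rcases stdBasis.orientation_eq_or_eq_neg O with h | h
    · refine ⟨1, one_ne_zero, fun b hb => ?_⟩
      rw [one_mul, ← Module.Basis.orientation_eq_iff_det_pos, hb, h]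
    · refine ⟨-1, by norm_num, fun b hb => ?_⟩
      have h1 : ¬ 0 < stdBasis.det b := by
        rw [← Module.Basis.orientation_eq_iff_det_pos, hb, h]
        exact Module.Ray.ne_neg_self _
      have h2 : stdBasis.det b ≠ 0 := (stdBasis.isUnit_det b).ne_zero
      have := lt_of_le_of_ne (not_lt.1 h1) h2
      linarith
  obtain ⟨σ, hσ, hb⟩ := key
  -- The tangent trivialization at `x₀` is the derivative of the chart there, so the locally
  -- constant orientation `O` fixes one sign of the determinant near `x₀`.
  refine ⟨σ, hσ, ?_⟩
  filter_upwards [hO, (chartAt E3 x₀).open_source.mem_nhds (mem_chart_source E3 x₀)] with x hx hxs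
  refine ⟨hxs, fun b hbo => ?_⟩
  obtain ⟨hy, hm⟩ := hx
  have h1 := TangentBundle.continuousLinearMapAt_trivializationAt (I := 𝓡 3) (𝕜 := ℝ) hxs
  set L := ((trivializationAt E3 (TangentSpace (𝓡 3) : M → Type _) x₀).continuousLinearEquivAt
          ℝ x hy).toLinearEquiv with hL
  have h2 : (b.map L).orientation = O := by
    rw [← hm, ← hbo, Module.Basis.orientation_map]
  have h3 := hb _ h2
  have h4 : (⇑(b.map L) : Fin 3 → E3) = fun i => chartDeriv x₀ x (b i) := by
    ext1 i
    rw [Module.Basis.map_apply]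
    have := DFunLike.congr_fun h1 (b i)
    refine Eq.trans ?_ this
    rw [hL, ← Trivialization.coe_continuousLinearEquivAt_eq _ hy]
    rfl
  rwa [h4] at h3

theorem exists_basis_orientation_eq (o : ManifoldOrientation M) (x : M) :
    ∃ b : Module.Basis (Fin 3) ℝ (TangentSpace (𝓡 3) x), b.orientation = o.orient x := by
  have h : Fintype.card (Fin 3) = Module.finrank ℝ (TangentSpace (𝓡 3) x) := by
    change _ = Module.finrank ℝ E3
    simp
  have : Nonempty (Fin 3) := ⟨0⟩
  have : FiniteDimensional ℝ (TangentSpace (𝓡 3) x) := inferInstanceAs (FiniteDimensional ℝ E3)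
  exact ⟨(o.orient x).someBasis h, (o.orient x).someBasis_orientation h⟩

/-- The linearization `α ∧ dβ + β ∧ dα` of `α ∧ dα` in the direction `β`. -/
noncomputable def linWedge (α β : OneForm M) (x : M) (u v w : TangentSpace (𝓡 3) x) : ℝ :=
  (α x u * dForm β x v w - α x v * dForm β x u w + α x w * dForm β x u v) +
  (β x u * dForm α x v w - β x v * dForm α x u w + β x w * dForm α x u v)

/-- `(α ∧ dβ + β ∧ dα)_x > 0` with respect to the orientation `o`. -/
def LinPos (o : ManifoldOrientation M) (α β : OneForm M) (x : M) : Prop :=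
  ∀ b : Module.Basis (Fin 3) ℝ (TangentSpace (𝓡 3) x), b.orientation = o.orient x →
    0 < linWedge α β x (b 0) (b 1) (b 2)

/-- `(α ∧ dβ + β ∧ dα)_x ≥ 0` with respect to the orientation `o`. -/
def LinNonneg (o : ManifoldOrientation M) (α β : OneForm M) (x : M) : Prop :=
  ∀ b : Module.Basis (Fin 3) ℝ (TangentSpace (𝓡 3) x), b.orientation = o.orient x →
    0 ≤ linWedge α β x (b 0) (b 1) (b 2)

/-- `σ` is the sign, at the point `x` of the chart at `x₀`, of the chart with respect to `o`:
positivity of 3-forms at `x` is positivity of `σ` times their densities in the chart. -/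
structure IsChartSign (o : ManifoldOrientation M) (x₀ : M) (σ : ℝ) (x : M) : Prop where
  mem_source : x ∈ (chartAt E3 x₀).source
  wedgePos_iff : ∀ α : OneForm M, IsSmoothForm α → (WedgePos o α x ↔
    0 < σ * density (formInChart α x₀) (formInChart α x₀) (extChartAt (𝓡 3) x₀ x))
  wedgeNonneg_iff : ∀ α : OneForm M, IsSmoothForm α → (WedgeNonneg o α x ↔
    0 ≤ σ * density (formInChart α x₀) (formInChart α x₀) (extChartAt (𝓡 3) x₀ x))
  linPos_iff : ∀ α β : OneForm M, IsSmoothForm α → IsSmoothForm β → (LinPos o α β x ↔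
    0 < σ * linDensity (formInChart α x₀) (formInChart β x₀) (extChartAt (𝓡 3) x₀ x))
  linNonneg_iff : ∀ α β : OneForm M, IsSmoothForm α → IsSmoothForm β → (LinNonneg o α β x ↔
    0 ≤ σ * linDensity (formInChart α x₀) (formInChart β x₀) (extChartAt (𝓡 3) x₀ x))

theorem exists_isChartSign (o : ManifoldOrientation M) (x₀ : M) :
    ∃ σ : ℝ, σ ≠ 0 ∧ ∀ᶠ x in 𝓝 x₀, IsChartSign o x₀ σ x := by
  obtain ⟨σ, hσ, h⟩ := exists_chart_sign o x₀
  refine ⟨σ, hσ, h.mono fun x hx => ?_⟩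
  obtain ⟨hxs, hb⟩ := hx
  obtain ⟨b₀, hb₀⟩ := exists_basis_orientation_eq o x
  have pos : ∀ (T : TangentSpace (𝓡 3) x → TangentSpace (𝓡 3) x → TangentSpace (𝓡 3) x → ℝ)
      (d : ℝ), (∀ b : Module.Basis (Fin 3) ℝ (TangentSpace (𝓡 3) x), T (b 0) (b 1) (b 2) =
        stdBasis.det (fun i => chartDeriv x₀ x (b i)) * d) →
      ((∀ b : Module.Basis (Fin 3) ℝ (TangentSpace (𝓡 3) x), b.orientation = o.orient x →
        0 < T (b 0) (b 1) (b 2)) ↔ 0 < σ * d) ∧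
      ((∀ b : Module.Basis (Fin 3) ℝ (TangentSpace (𝓡 3) x), b.orientation = o.orient x →
        0 ≤ T (b 0) (b 1) (b 2)) ↔ 0 ≤ σ * d) := by
    intro T d hT
    have hσ2 : 0 < σ ^ 2 := by positivity
    -- The first factor on the right is positive on oriented bases, so `T` and `σ * d` have the same
    -- sign.
    have e : ∀ b : Module.Basis (Fin 3) ℝ (TangentSpace (𝓡 3) x), σ ^ 2 * T (b 0) (b 1) (b 2) =
        (σ * stdBasis.det (fun i => chartDeriv x₀ x (b i))) * (σ * d) := fun b => by
      rw [hT b]; ring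
    refine ⟨⟨fun H => ?_, fun H b hbo => ?_⟩, ⟨fun H => ?_, fun H b hbo => ?_⟩⟩
    · exact pos_of_mul_pos_right (e b₀ ▸ mul_pos hσ2 (H b₀ hb₀)) (hb b₀ hb₀).le
    · exact pos_of_mul_pos_right (e b ▸ mul_pos (hb b hbo) H) hσ2.le
    · exact nonneg_of_mul_nonneg_right (e b₀ ▸ mul_nonneg hσ2.le (H b₀ hb₀)) (hb b₀ hb₀)
    · exact nonneg_of_mul_nonneg_right (e b ▸ mul_nonneg (hb b hbo).le H) hσ2
  have hmix : ∀ α β : OneForm M, IsSmoothForm β →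
      ∀ b : Module.Basis (Fin 3) ℝ (TangentSpace (𝓡 3) x),
      α x (b 0) * dForm β x (b 1) (b 2) - α x (b 1) * dForm β x (b 0) (b 2)
        + α x (b 2) * dForm β x (b 0) (b 1) =
      stdBasis.det (fun i => chartDeriv x₀ x (b i)) *
        density (formInChart α x₀) (formInChart β x₀) (extChartAt (𝓡 3) x₀ x) := by
    intro α β hβ b
    rw [← wedge3_eq_det_mul]
    rw [wedge3, dForm_eq_curl hβ hxs (b 1) (b 2), dForm_eq_curl hβ hxs (b 0) (b 2),
      dForm_eq_curl hβ hxs (b 0) (b 1), ← formInChart_chartDeriv α hxs (b 0), ← formInChart_chartDeriv α hxs (b 1),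
      ← formInChart_chartDeriv α hxs (b 2)]
  have hlin : ∀ α β : OneForm M, IsSmoothForm α → IsSmoothForm β →
      ∀ b : Module.Basis (Fin 3) ℝ (TangentSpace (𝓡 3) x),
      linWedge α β x (b 0) (b 1) (b 2) =
      stdBasis.det (fun i => chartDeriv x₀ x (b i)) *
        linDensity (formInChart α x₀) (formInChart β x₀) (extChartAt (𝓡 3) x₀ x) := by
    intro α β hα hβ b
    rw [linWedge, hmix α β hβ b, hmix β α hα b, linDensity, mul_add]
  exact ⟨hxs, fun α hα => (pos (wedgeD α x) _ (hmix α α hα)).1,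
    fun α hα => (pos (wedgeD α x) _ (hmix α α hα)).2,
    fun α β hα hβ => (pos (linWedge α β x) _ (hlin α β hα hβ)).1,
    fun α β hα hβ => (pos (linWedge α β x) _ (hlin α β hα hβ)).2⟩

end Sign

/-! ### Admissible infinitesimal deformations and good points -/

section Forms

variable {M : Type*} [TopologicalSpace M] [ChartedSpace E3 M]

theorem formInChart_add (α β : OneForm M) (x₀ : M) :
    formInChart (α + β) x₀ = formInChart α x₀ + formInChart β x₀ := rfl

theorem formInChart_smul (t : ℝ) (α : OneForm M) (x₀ : M) :
    formInChart (t • α) x₀ = t • formInChart α x₀ := rfl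

theorem formInChart_congr {α β : OneForm M} {x₀ x : M} (hx : x ∈ (chartAt E3 x₀).source)
    (h : ∀ᶠ z in 𝓝 x, α z = β z) :
    formInChart α x₀ =ᶠ[𝓝 (extChartAt (𝓡 3) x₀ x)] formInChart β x₀ := by
  have hc : ContinuousAt (extChartAt (𝓡 3) x₀).symm (extChartAt (𝓡 3) x₀ x) :=
    continuousAt_extChartAt_symm' (by simpa using hx)
  have hx' : (extChartAt (𝓡 3) x₀).symm (extChartAt (𝓡 3) x₀ x) = x :=
    (extChartAt (𝓡 3) x₀).left_inv (by simpa using hx)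
  rw [← hx'] at h
  filter_upwards [hc.eventually h] with y hy
  simp only [formInChart, hy]

theorem formInChart_zero (x₀ : M) : formInChart (0 : OneForm M) x₀ = 0 := rfl

variable [IsManifold (𝓡 3) ∞ M]

theorem isSmoothForm_of_formInChart {α : OneForm M}
    (h : ∀ x, ContDiffAt ℝ ∞ (formInChart α x) (extChartAt (𝓡 3) x x)) : IsSmoothForm α :=
  fun x => contMDiffAt_of_formInChart (mem_chart_source E3 x) (h x)

theorem IsSmoothForm.add {α β : OneForm M} (hα : IsSmoothForm α) (hβ : IsSmoothForm β) :
    IsSmoothForm (α + β) :=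
  isSmoothForm_of_formInChart fun x => by
    rw [formInChart_add]
    exact (hα.contDiffAt (mem_extChartAt_target x)).add (hβ.contDiffAt (mem_extChartAt_target x))

theorem IsSmoothForm.smul {α : OneForm M} (hα : IsSmoothForm α) (t : ℝ) :
    IsSmoothForm (t • α) :=
  isSmoothForm_of_formInChart fun x => by
    rw [formInChart_smul]
    exact (hα.contDiffAt (mem_extChartAt_target x)).const_smul t

theorem isSmoothForm_zero : IsSmoothForm (0 : OneForm M) :=
  isSmoothForm_of_formInChart fun x => by
    have : formInChart (0 : OneForm M) x = 0 := rfl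
    rw [this]; exact contDiffAt_const

theorem linDensity_zero (A : E3 → E3 →L[ℝ] ℝ) (y : E3) : linDensity A 0 y = 0 := by
  simpa using linDensity_smul (A := A) (B := 0) (y := y) 0

theorem linNonneg_of_eventually_zero (o : ManifoldOrientation M) {α β : OneForm M}
    (hα : IsSmoothForm α) (hβ : IsSmoothForm β) {x : M} (h : ∀ᶠ z in 𝓝 x, β z = 0) :
    LinNonneg o α β x := by
  obtain ⟨σ, -, hs⟩ := exists_isChartSign o x
  rw [hs.self_of_nhds.linNonneg_iff α β hα hβ,
    linDensity_congr (B' := formInChart (0 : OneForm M) x)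
      (formInChart_congr (mem_chart_source E3 x) h), formInChart_zero, linDensity_zero, mul_zero]

theorem IsSmoothForm.differentiableAt {α : OneForm M} (hα : IsSmoothForm α) {x₀ x : M}
    (hx : x ∈ (chartAt E3 x₀).source) :
    DifferentiableAt ℝ (formInChart α x₀) (extChartAt (𝓡 3) x₀ x) :=
  (hα.contDiffAt ((extChartAt (𝓡 3) x₀).map_source (by simpa using hx))).differentiableAt (by simp)

theorem linNonneg_add {o : ManifoldOrientation M} {α β γ : OneForm M} (hα : IsSmoothForm α)
    (hβ : IsSmoothForm β) (hγ : IsSmoothForm γ) {x : M} (h : LinNonneg o α β x)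
    (h' : LinNonneg o α γ x) : LinNonneg o α (β + γ) x := by
  obtain ⟨σ, -, hs⟩ := exists_isChartSign o x
  have hs := hs.self_of_nhds
  rw [hs.linNonneg_iff _ _ hα hβ] at h
  rw [hs.linNonneg_iff _ _ hα hγ] at h'
  rw [hs.linNonneg_iff _ _ hα (hβ.add hγ), formInChart_add,
    linDensity_add (hβ.differentiableAt hs.mem_source) (hγ.differentiableAt hs.mem_source)]
  linarith

theorem linPos_add {o : ManifoldOrientation M} {α β γ : OneForm M} (hα : IsSmoothForm α)
    (hβ : IsSmoothForm β) (hγ : IsSmoothForm γ) {x : M} (h : LinPos o α β x)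
    (h' : LinNonneg o α γ x) : LinPos o α (β + γ) x := by
  obtain ⟨σ, -, hs⟩ := exists_isChartSign o x
  have hs := hs.self_of_nhds
  rw [hs.linPos_iff _ _ hα hβ] at h
  rw [hs.linNonneg_iff _ _ hα hγ] at h'
  rw [hs.linPos_iff _ _ hα (hβ.add hγ), formInChart_add,
    linDensity_add (hβ.differentiableAt hs.mem_source) (hγ.differentiableAt hs.mem_source)]
  linarith

theorem linNonneg_smul {o : ManifoldOrientation M} {α β : OneForm M} (hα : IsSmoothForm α)
    (hβ : IsSmoothForm β) {x : M} (h : LinNonneg o α β x) {t : ℝ} (ht : 0 ≤ t) :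
    LinNonneg o α (t • β) x := by
  obtain ⟨σ, -, hs⟩ := exists_isChartSign o x
  have hs := hs.self_of_nhds
  rw [hs.linNonneg_iff _ _ hα hβ] at h
  rw [hs.linNonneg_iff _ _ hα (hβ.smul t), formInChart_smul, linDensity_smul]
  have := mul_nonneg ht h
  linarith

theorem IsSmoothForm.continuousAt_density {α β : OneForm M} (hα : IsSmoothForm α)
    (hβ : IsSmoothForm β) {x₀ : M} {y : E3} (hy : y ∈ (extChartAt (𝓡 3) x₀).target) :
    ContinuousAt (density (formInChart α x₀) (formInChart β x₀)) y :=
  Confoliation.continuousAt_density ((hα.contDiffAt hy).of_le (by simp))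
    ((hβ.contDiffAt hy).of_le (by simp))

theorem IsSmoothForm.continuousAt_linDensity {α β : OneForm M} (hα : IsSmoothForm α)
    (hβ : IsSmoothForm β) {x₀ : M} {y : E3} (hy : y ∈ (extChartAt (𝓡 3) x₀).target) :
    ContinuousAt (linDensity (formInChart α x₀) (formInChart β x₀)) y :=
  (hα.continuousAt_density hβ hy).add (hβ.continuousAt_density hα hy)

theorem isOpen_wedgePos (o : ManifoldOrientation M) {α : OneForm M} (hα : IsSmoothForm α) :
    IsOpen {x | WedgePos o α x} := by
  rw [isOpen_iff_mem_nhds]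
  intro x hx
  obtain ⟨σ, -, hs⟩ := exists_isChartSign o x
  have h1 := (hs.self_of_nhds.wedgePos_iff α hα).1 hx
  have h2 : ContinuousAt (fun z => σ * density (formInChart α x) (formInChart α x)
      (extChartAt (𝓡 3) x z)) x :=
    continuousAt_const.mul ((hα.continuousAt_density hα (mem_extChartAt_target x)).comp
      (continuousAt_extChartAt x))
  filter_upwards [hs, h2.eventually (lt_mem_nhds h1)] with z hz hz'
  exact (hz.wedgePos_iff α hα).2 hz'

theorem isOpen_linPos (o : ManifoldOrientation M) {α β : OneForm M} (hα : IsSmoothForm α)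
    (hβ : IsSmoothForm β) : IsOpen {x | LinPos o α β x} := by
  rw [isOpen_iff_mem_nhds]
  intro x hx
  obtain ⟨σ, -, hs⟩ := exists_isChartSign o x
  have h1 := (hs.self_of_nhds.linPos_iff α β hα hβ).1 hx
  have h2 : ContinuousAt (fun z => σ * linDensity (formInChart α x) (formInChart β x)
      (extChartAt (𝓡 3) x z)) x :=
    continuousAt_const.mul ((hα.continuousAt_linDensity hβ (mem_extChartAt_target x)).comp
      (continuousAt_extChartAt x))
  filter_upwards [hs, h2.eventually (lt_mem_nhds h1)] with z hz hz'
  exact (hz.linPos_iff α β hα hβ).2 hz'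

/-- The form `β` is an infinitesimal deformation of `α` which nowhere destroys the inequality
`α ∧ dα ≥ 0` to first order. -/
def IsAdmissible (o : ManifoldOrientation M) (α β : OneForm M) : Prop :=
  IsSmoothForm β ∧ ∀ x, ¬ WedgePos o α x → LinNonneg o α β x

/-- The points at which `α` is contact or can be made contact, to first order, by an admissible
infinitesimal deformation. -/
def goodSet (o : ManifoldOrientation M) (α : OneForm M) : Set M :=
  {x | ∃ β, IsAdmissible o α β ∧ (¬ WedgePos o α x → LinPos o α β x)}

theorem isAdmissible_zero (o : ManifoldOrientation M) {α : OneForm M} (hα : IsSmoothForm α) :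
    IsAdmissible o α 0 :=
  ⟨isSmoothForm_zero, fun _ _ => linNonneg_of_eventually_zero o hα isSmoothForm_zero
    (Eventually.of_forall fun _ => rfl)⟩

theorem mem_goodSet_of_wedgePos {o : ManifoldOrientation M} {α : OneForm M} (hα : IsSmoothForm α)
    {x : M} (hx : WedgePos o α x) : x ∈ goodSet o α :=
  ⟨0, isAdmissible_zero o hα, fun h => absurd hx h⟩

theorem isOpen_goodSet (o : ManifoldOrientation M) {α : OneForm M} (hα : IsSmoothForm α) :
    IsOpen (goodSet o α) := by
  rw [isOpen_iff_mem_nhds]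
  rintro x ⟨β, hβ, h⟩
  by_cases hx : WedgePos o α x
  · filter_upwards [(isOpen_wedgePos o hα).mem_nhds hx] with z hz
    exact mem_goodSet_of_wedgePos hα hz
  · filter_upwards [(isOpen_linPos o hα hβ.1).mem_nhds (h hx)] with z hz
    exact ⟨β, hβ, fun _ => hz⟩

/-- Adding an admissible form never destroys strict positivity at a non-contact point, so local
solutions are summed over a finite cover; no partition of unity is needed. -/
theorem exists_admissible_of_isCompact {o : ManifoldOrientation M} {α : OneForm M}
    (hα : IsSmoothForm α) {K : Set M} (hK : IsCompact K) (hKg : K ⊆ goodSet o α) :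
    ∃ β, IsAdmissible o α β ∧ ∀ x ∈ K, ¬ WedgePos o α x → LinPos o α β x := by
  refine IsCompact.induction_on hK (p := fun K => ∃ β, IsAdmissible o α β ∧
    ∀ x ∈ K, ¬ WedgePos o α x → LinPos o α β x) ?_ ?_ ?_ ?_
  · exact ⟨0, isAdmissible_zero o hα, fun x hx => absurd hx (notMem_empty x)⟩
  · rintro s t hst ⟨β, hβ, h⟩
    exact ⟨β, hβ, fun x hx => h x (hst hx)⟩
  · rintro s t ⟨β, hβ, h⟩ ⟨γ, hγ, h'⟩
    refine ⟨β + γ, ⟨hβ.1.add hγ.1, fun x hx => linNonneg_add hα hβ.1 hγ.1 (hβ.2 x hx) (hγ.2 x hx)⟩,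
      fun x hx hxz => ?_⟩
    rcases hx with hx | hx
    · exact linPos_add hα hβ.1 hγ.1 (h x hx hxz) (hγ.2 x hxz)
    · rw [add_comm]
      exact linPos_add hα hγ.1 hβ.1 (h' x hx hxz) (hβ.2 x hxz)
  · intro x hx
    obtain ⟨β, hβ, h⟩ := hKg hx
    by_cases hxz : WedgePos o α x
    · refine ⟨{x | WedgePos o α x}, mem_nhdsWithin_of_mem_nhds ((isOpen_wedgePos o hα).mem_nhds hxz),
        β, hβ, fun z hz hz' => absurd hz hz'⟩
    · exact ⟨{x | LinPos o α β x},
        mem_nhdsWithin_of_mem_nhds ((isOpen_linPos o hα hβ.1).mem_nhds (h hxz)),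
        β, hβ, fun z hz _ => hz⟩

end Forms

/-! ### From a first-order solution to a contact deformation -/

section Deformation

variable {M : Type*} [TopologicalSpace M] [ChartedSpace E3 M] [IsManifold (𝓡 3) ∞ M]

theorem contMDiff_affine_family {α β : OneForm M} (hα : IsSmoothForm α) (hβ : IsSmoothForm β) :
    ContMDiff (𝓘(ℝ, ℝ).prod (𝓡 3)) ((𝓡 3).prod 𝓘(ℝ, E3 →L[ℝ] ℝ)) ∞
      (fun p : ℝ × M => (TotalSpace.mk' (E3 →L[ℝ] ℝ)
        (E := fun x : M => TangentSpace (𝓡 3) x →L[ℝ] Bundle.Trivial M ℝ x) p.2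
          ((α + p.1 • β) p.2))) := by
  rintro ⟨t₀, x₀⟩
  rw [contMDiffAt_totalSpace]
  refine ⟨contMDiffAt_snd, ?_⟩
  have h1 : ∀ γ : OneForm M, IsSmoothForm γ →
      ContMDiffAt (𝓘(ℝ, ℝ).prod (𝓡 3)) 𝓘(ℝ, E3 →L[ℝ] ℝ) ∞
        (fun p : ℝ × M => formInChart γ x₀ (extChartAt (𝓡 3) x₀ p.2)) (t₀, x₀) := fun γ hγ =>
    ((contMDiffAt_form_iff γ (mem_chart_source E3 x₀)).1 (hγ x₀)).comp (t₀, x₀) contMDiffAt_snd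
  have h2 := (h1 α hα).add ((contMDiffAt_fst (I := 𝓘(ℝ, ℝ)) (J := 𝓡 3) (n := ∞)
    (p := (t₀, x₀))).smul (h1 β hβ))
  refine h2.congr_of_eventuallyEq ?_
  filter_upwards [continuousAt_snd.preimage_mem_nhds
    ((chartAt E3 x₀).open_source.mem_nhds (mem_chart_source E3 x₀))] with p hp
  exact trivializationAt_form_snd (α + p.1 • β) hp

/-- In the chart the density is `a + t(l + tb)`. Either `a > 0` at `x₀`, and continuity suffices, or
`l > 0` at `x₀`, and `a ≥ 0` nearby leaves the positive term `t(l + tb)`. -/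
theorem eventually_wedgePos_add_smul {o : ManifoldOrientation M} {α β : OneForm M}
    (hα : IsSmoothForm α) (hβ : IsSmoothForm β) (hn : ∀ x, WedgeNonneg o α x) {x₀ : M}
    (hpos : ¬ WedgePos o α x₀ → LinPos o α β x₀) :
    ∀ᶠ p : ℝ × M in 𝓝 (0, x₀), 0 < p.1 → WedgePos o (α + p.1 • β) p.2 := by
  obtain ⟨σ, -, hs⟩ := exists_isChartSign o x₀
  have hs₀ := hs.self_of_nhds
  set a : M → ℝ := fun x => σ * density (formInChart α x₀) (formInChart α x₀)
    (extChartAt (𝓡 3) x₀ x) with ha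
  set l : M → ℝ := fun x => σ * linDensity (formInChart α x₀) (formInChart β x₀)
    (extChartAt (𝓡 3) x₀ x) with hl
  set b : M → ℝ := fun x => σ * density (formInChart β x₀) (formInChart β x₀)
    (extChartAt (𝓡 3) x₀ x) with hb
  have hx₀ := mem_extChartAt_target (I := 𝓡 3) x₀
  have hca : ContinuousAt (fun p : ℝ × M => a p.2) (0, x₀) :=
    (continuousAt_const.mul ((hα.continuousAt_density hα hx₀).comp
      (continuousAt_extChartAt x₀))).comp_of_eq continuousAt_snd rfl
  have hcl : ContinuousAt (fun p : ℝ × M => l p.2) (0, x₀) :=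
    (continuousAt_const.mul ((hα.continuousAt_linDensity hβ hx₀).comp
      (continuousAt_extChartAt x₀))).comp_of_eq continuousAt_snd rfl
  have hcb : ContinuousAt (fun p : ℝ × M => b p.2) (0, x₀) :=
    (continuousAt_const.mul ((hβ.continuousAt_density hβ hx₀).comp
      (continuousAt_extChartAt x₀))).comp_of_eq continuousAt_snd rfl
  have hct : ContinuousAt (fun p : ℝ × M => p.1) (0, x₀) := continuousAt_fst
  have hs2 : ∀ᶠ p : ℝ × M in 𝓝 (0, x₀), IsChartSign o x₀ σ p.2 :=
    continuousAt_snd.eventually hs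
  have key : ∀ p : ℝ × M, IsChartSign o x₀ σ p.2 →
      0 < a p.2 + p.1 * (l p.2 + p.1 * b p.2) → WedgePos o (α + p.1 • β) p.2 := by
    intro p hp h
    rw [hp.wedgePos_iff _ (hα.add (hβ.smul _)), formInChart_add, formInChart_smul,
      density_add_smul (hα.differentiableAt hp.mem_source) (hβ.differentiableAt hp.mem_source)]
    refine h.trans_eq ?_
    simp only [ha, hl, hb]
    ring
  by_cases hx : WedgePos o α x₀
  · have h0 := (hs₀.wedgePos_iff α hα).1 hx
    have hc := hca.add (hct.mul (hcl.add (hct.mul hcb)))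
    have h1 : 0 < a x₀ + 0 * (l x₀ + 0 * b x₀) := by rw [zero_mul, add_zero]; exact h0
    filter_upwards [hs2, hc.eventually (lt_mem_nhds h1)] with p hp hp' _
    exact key p hp hp'
  · have h0 := (hs₀.linPos_iff α β hα hβ).1 (hpos hx)
    have hc := hcl.add (hct.mul hcb)
    have h1 : 0 < l x₀ + 0 * b x₀ := by rw [zero_mul, add_zero]; exact h0
    filter_upwards [hs2, hc.eventually (lt_mem_nhds h1)] with p hp hp' ht
    have h1 := (hp.wedgeNonneg_iff α hα).1 (hn p.2)
    exact key p hp (add_pos_of_nonneg_of_pos h1 (mul_pos ht hp'))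

theorem WedgePos.ne_zero {o : ManifoldOrientation M} {α : OneForm M} {x : M}
    (h : WedgePos o α x) : α x ≠ 0 := by
  intro h0
  obtain ⟨b, hb⟩ := exists_basis_orientation_eq o x
  have := h b hb
  simp [wedgeD, h0] at this

theorem canBeDeformedToContact_of_linPos [CompactSpace M] {o : ManifoldOrientation M}
    {ξ : PlaneField M} {α β : OneForm M} (hξ : IsDefiningForm ξ α) (hβ : IsSmoothForm β)
    (hn : ∀ x, WedgeNonneg o α x) (hpos : ∀ x, ¬ WedgePos o α x → LinPos o α β x) :
    CanBeDeformedToContact o ξ := by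
  have hev := isCompact_univ.eventually_forall_of_forall_eventually (x₀ := (0 : ℝ))
    (P := fun t x => 0 < t → WedgePos o (α + t • β) x) fun x (_ : x ∈ (univ : Set M)) =>
      eventually_wedgePos_add_smul hξ.1 hβ hn (hpos x)
  obtain ⟨ε, hε, h⟩ := Metric.eventually_nhds_iff.1 hev
  -- Halving `ε` fits the closed parameter interval inside the open ball of radius `ε`.
  have hw : ∀ t ∈ Ioc (0 : ℝ) (ε / 2), ∀ x, WedgePos o (α + t • β) x := fun t ht x =>
    h (by rw [Real.dist_eq, sub_zero, abs_of_pos ht.1]; linarith [ht.2]) x (mem_univ x) ht.1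
  have h0 : α + (0 : ℝ) • β = α := by simp
  refine ⟨ε / 2, half_pos hε, fun t x => LinearMap.ker ((α + t • β) x).toLinearMap, ?_, ?_, ?_⟩
  · intro t₀ _ x₀
    refine ⟨univ, univ_mem, fun t => α + t • β, (contMDiff_affine_family hξ.1 hβ).contMDiffOn, ?_⟩
    rintro ⟨t, x⟩ ⟨-, ht, -⟩
    refine ⟨?_, fun v => LinearMap.mem_ker⟩
    rcases eq_or_lt_of_le ht.1 with h' | h'
    · have : t = 0 := h'.symm
      subst this
      change (α + (0 : ℝ) • β) x ≠ 0
      rw [h0]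
      exact (hξ.2 x).1
    · exact (hw t ⟨h', ht.2⟩ x).ne_zero
  · funext x
    ext v
    change v ∈ LinearMap.ker ((α + (0 : ℝ) • β) x).toLinearMap ↔ v ∈ ξ x
    rw [h0, LinearMap.mem_ker]
    exact ((hξ.2 x).2 v).symm
  · intro t ht
    exact ⟨α + t • β, ⟨hξ.1.add (hβ.smul t), fun x => ⟨(hw t ht x).ne_zero,
      fun v => LinearMap.mem_ker⟩⟩, hw t ht⟩

/-- If `α'` is another defining form of the same plane field, then `α ∧ dα > 0` wherever
`α' ∧ dα' > 0`, provided `α ∧ dα ≥ 0`. -/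
theorem wedgePos_of_mem_hotZone {o : ManifoldOrientation M} {ξ : PlaneField M} {α : OneForm M}
    (hα : IsDefiningForm ξ α) {x : M} (hx : x ∈ hotZone o ξ) : WedgePos o α x := by
  obtain ⟨α', hα', hw⟩ := hx
  obtain ⟨σ, -, hs⟩ := exists_isChartSign o x
  have hs := hs.self_of_nhds
  have hxs := mem_chart_source E3 x
  set A := formInChart α x
  set A' := formInChart α' x
  set y₀ := extChartAt (𝓡 3) x x
  obtain ⟨v, hv⟩ : ∃ v, A' y₀ v ≠ 0 := by
    obtain ⟨u, hu⟩ : ∃ u, α' x u ≠ 0 := by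
      by_contra! h
      exact (hα'.2 x).1 (ContinuousLinearMap.ext h)
    exact ⟨chartDeriv x x u, by rwa [formInChart_chartDeriv α' hxs u]⟩
  have hA : DifferentiableAt ℝ A y₀ := hα.1.differentiableAt hxs
  have hA' : DifferentiableAt ℝ A' y₀ := hα'.1.differentiableAt hxs
  have hAv : DifferentiableAt ℝ (fun y => A y v) y₀ := hA.clm_apply (differentiableAt_const v)
  have hAv' : DifferentiableAt ℝ (fun y => A' y v) y₀ := hA'.clm_apply (differentiableAt_const v)
  have hker : ∀ y w, A' y w = 0 → A y w = 0 := fun y w h =>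
    ((hα.2 _).2 _).1 (((hα'.2 _).2 _).2 h)
  have hv' : ∀ᶠ y in 𝓝 y₀, A' y v ≠ 0 :=
    hAv'.continuousAt.eventually_ne hv
  set f : E3 → ℝ := fun y => A y v / A' y v with hf
  have hfA : A =ᶠ[𝓝 y₀] fun y => f y • A' y := by
    filter_upwards [hv'] with y hy
    ext w
    -- Projecting `w` along `v` into the kernel of `A'`, which lies in that of `A`, exhibits `A` as
    -- `f • A'`.
    have h1 := hker y (w - (A' y w / A' y v) • v) (by
      rw [map_sub, map_smul, smul_eq_mul, div_mul_cancel₀ _ hy, sub_self])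
    rw [map_sub, map_smul, smul_eq_mul, sub_eq_zero] at h1
    rw [h1, smul_apply, smul_eq_mul, show f y = A y v / A' y v from rfl]
    field_simp
  have hfd : DifferentiableAt ℝ f y₀ := by
    simp only [hf, div_eq_mul_inv]
    exact hAv.fun_mul (hAv'.fun_inv hv)
  have hf0 : f y₀ ≠ 0 := by
    intro h
    have h1 : A y₀ = 0 := by
      refine hfA.self_of_nhds.trans ?_
      change f y₀ • A' y₀ = 0
      rw [h, zero_smul]
    refine (hα.2 x).1 (ContinuousLinearMap.ext fun u => ?_)
    have := formInChart_chartDeriv α hxs u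
    rw [← this]
    change A y₀ _ = 0
    rw [h1]; rfl
  -- The `df` term is `A' ∧ df ∧ A' = 0`, so the factor is a square and the sign of `f` is
  -- irrelevant.
  have hd : density A A y₀ = f y₀ ^ 2 * density A' A' y₀ := by
    rw [density_congr (A' := fun y => f y • A' y) hfA.self_of_nhds hfA, density_fun_smul_left,
      density_fun_smul_right hfd hA', det3_self_right]
    ring
  rw [hs.wedgePos_iff α hα.1]
  rw [hs.wedgePos_iff α' hα'.1] at hw
  change 0 < σ * density A A y₀
  rw [hd]
  have : 0 < f y₀ ^ 2 := by positivity
  have := mul_pos this hw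
  linarith

end Deformation

/-! ### Forms supported in a chart and their correction -/

section Local

variable {M : Type*} [TopologicalSpace M] [ChartedSpace E3 M]

/-- The form which is `F • c` in the chart at `x₀` and vanishes outside this chart. -/
noncomputable def bumpForm (x₀ : M) (F : E3 → ℝ) (c : E3 →L[ℝ] ℝ) : OneForm M := fun x =>
  ((chartAt E3 x₀).source.indicator (F ∘ extChartAt (𝓡 3) x₀) x •
    c.comp (chartDeriv x₀ x) :)

theorem bumpForm_eventually_eq_zero [T2Space M] {x₀ : M} {F : E3 → ℝ} (c : E3 →L[ℝ] ℝ) {K : Set E3}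
    (hK : IsCompact K) (hKt : K ⊆ (extChartAt (𝓡 3) x₀).target) (hFK : ∀ y, y ∉ K → F y = 0)
    {x : M} (hx : x ∉ (extChartAt (𝓡 3) x₀).symm '' K) :
    ∀ᶠ z in 𝓝 x, bumpForm x₀ F c z = 0 := by
  -- Hausdorffness enters here: the compact support is closed in `M`, so extension by zero is
  -- smooth.
  have hc : IsClosed ((extChartAt (𝓡 3) x₀).symm '' K) :=
    (hK.image_of_continuousOn ((continuousOn_extChartAt_symm x₀).mono hKt)).isClosed
  filter_upwards [hc.isOpen_compl.mem_nhds hx] with z hz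
  have : (chartAt E3 x₀).source.indicator (F ∘ extChartAt (𝓡 3) x₀) z = 0 := by
    by_cases h : z ∈ (chartAt E3 x₀).source
    · rw [indicator_of_mem h]
      apply hFK
      intro hzK
      exact hz ⟨_, hzK, (extChartAt (𝓡 3) x₀).left_inv (by simpa using h)⟩
    · exact indicator_of_notMem h _
  have h2 : bumpForm x₀ F c z = ((chartAt E3 x₀).source.indicator
    (F ∘ extChartAt (𝓡 3) x₀) z • c.comp (chartDeriv x₀ z) :) := rfl
  rw [h2, this, zero_smul]
  rfl

variable [IsManifold (𝓡 3) ∞ M]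

theorem formInChart_bumpForm {x₀ : M} (F : E3 → ℝ) (c : E3 →L[ℝ] ℝ) {y : E3}
    (hy : y ∈ (extChartAt (𝓡 3) x₀).target) : formInChart (bumpForm x₀ F c) x₀ y = F y • c := by
  have hs : (extChartAt (𝓡 3) x₀).symm y ∈ (chartAt E3 x₀).source := by
    simpa using (extChartAt (𝓡 3) x₀).map_target hy
  have h := mfderiv_extChartAt_comp_mfderivWithin_extChartAt_symm (I := 𝓡 3) hy
  rw [ModelWithCorners.range_eq_univ, mfderivWithin_univ] at h
  ext v
  have h' : chartDeriv x₀ ((extChartAt (𝓡 3) x₀).symm y)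
    (mfderiv 𝓘(ℝ, E3) (𝓡 3) (extChartAt (𝓡 3) x₀).symm y v) = v := DFunLike.congr_fun h v
  have h2 : formInChart (bumpForm x₀ F c) x₀ y v =
      (chartAt E3 x₀).source.indicator (F ∘ extChartAt (𝓡 3) x₀) ((extChartAt (𝓡 3) x₀).symm y) *
      c (chartDeriv x₀ ((extChartAt (𝓡 3) x₀).symm y)
        (mfderiv 𝓘(ℝ, E3) (𝓡 3) (extChartAt (𝓡 3) x₀).symm y v)) := rfl
  rw [h2, h', indicator_of_mem hs, Function.comp_apply, (extChartAt (𝓡 3) x₀).right_inv hy]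
  rfl

theorem isSmoothForm_bumpForm [T2Space M] {x₀ : M} {F : E3 → ℝ} (hF : ContDiff ℝ ∞ F)
    (c : E3 →L[ℝ] ℝ) {K : Set E3}
    (hK : IsCompact K) (hKt : K ⊆ (extChartAt (𝓡 3) x₀).target) (hFK : ∀ y, y ∉ K → F y = 0) :
    IsSmoothForm (bumpForm x₀ F c) := by
  intro x
  by_cases hx : x ∈ (chartAt E3 x₀).source
  · refine contMDiffAt_of_formInChart hx ?_
    have ht : extChartAt (𝓡 3) x₀ x ∈ (extChartAt (𝓡 3) x₀).target :=
      (extChartAt (𝓡 3) x₀).map_source (by simpa using hx)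
    refine (hF.contDiffAt.smul (contDiffAt_const (c := c))).congr_of_eventuallyEq ?_
    filter_upwards [extChartAt_target_mem_nhds' (I := 𝓡 3) ht] with y hy
    exact formInChart_bumpForm F c hy
  · have hx' : x ∉ (extChartAt (𝓡 3) x₀).symm '' K := by
      rintro ⟨y, hy, rfl⟩
      exact hx (by simpa using (extChartAt (𝓡 3) x₀).map_target (hKt hy))
    refine contMDiffAt_of_formInChart (mem_chart_source E3 x) ?_
    refine ContDiffAt.congr_of_eventuallyEq (f := 0) contDiffAt_const ?_
    exact (formInChart_congr (β := 0) (mem_chart_source E3 x)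
      (bumpForm_eventually_eq_zero c hK hKt hFK hx'))

/-- The local form `F • c` may have the wrong sign on `B`, but `B` is compact and consists of good
points. A sufficiently large multiple of an admissible form that is strict on `B` absorbs the error
and does no harm elsewhere. -/
theorem mem_goodSet_of_chart [T2Space M] {o : ManifoldOrientation M} {α : OneForm M}
    (hα : IsSmoothForm α) {x₀ : M} {σ : ℝ} {K B : Set E3} (hK : IsCompact K) (hB : IsCompact B)
    (hBK : B ⊆ K) (hKt : K ⊆ (extChartAt (𝓡 3) x₀).target)
    (hσ : ∀ y ∈ K, IsChartSign o x₀ σ ((extChartAt (𝓡 3) x₀).symm y))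
    (hBg : ∀ y ∈ B, (extChartAt (𝓡 3) x₀).symm y ∈ goodSet o α)
    {F : E3 → ℝ} (hF : ContDiff ℝ ∞ F) (hFK : ∀ y, y ∉ K → F y = 0) (c : E3 →L[ℝ] ℝ)
    (hnonneg : ∀ y ∈ K, y ∉ B → 0 ≤ σ * linDensity (formInChart α x₀) (fun z => F z • c) y)
    {p : E3} (hpK : p ∈ K) (hp : 0 < σ * linDensity (formInChart α x₀) (fun z => F z • c) p) :
    (extChartAt (𝓡 3) x₀).symm p ∈ goodSet o α := by
  by_cases hpB : p ∈ B
  · exact hBg p hpB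
  set ψ := (extChartAt (𝓡 3) x₀).symm with hψ
  set A := formInChart α x₀ with hA
  set β₀ : OneForm M := bumpForm x₀ F c with hβ₀
  have hs₀ : IsSmoothForm β₀ := isSmoothForm_bumpForm hF c hK hKt hFK
  have hψr : ∀ y ∈ K, extChartAt (𝓡 3) x₀ (ψ y) = y := fun y hy =>
    (extChartAt (𝓡 3) x₀).right_inv (hKt hy)
  have hlin₀ : ∀ y ∈ K, linDensity A (formInChart β₀ x₀) y = linDensity A (fun z => F z • c) y := by
    intro y hy
    apply linDensity_congr
    filter_upwards [extChartAt_target_mem_nhds' (I := 𝓡 3) (hKt hy)] with z hz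
    exact formInChart_bumpForm F c hz
  obtain ⟨β₁, hβ₁, hβ₁pos⟩ := exists_admissible_of_isCompact (o := o) hα
    (hB.image_of_continuousOn ((continuousOn_extChartAt_symm x₀).mono (hBK.trans hKt)))
    (by rintro _ ⟨y, hy, rfl⟩; exact hBg y hy)
  -- The non-contact points of `B`: a compact set on which the linear term of `β₁` is strictly
  -- positive, so the quotient below is bounded.
  set Z : Set E3 := B ∩ (fun y => σ * density A A y) ⁻¹' Iic 0 with hZ
  have hZc : IsCompact Z := by
    refine hB.of_isClosed_subset ?_ inter_subset_left
    refine ContinuousOn.preimage_isClosed_of_isClosed ?_ hB.isClosed isClosed_Iic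
    exact fun y hy => (continuousAt_const.mul
      (hα.continuousAt_density hα (hKt (hBK hy)))).continuousWithinAt
  have hZw : ∀ y ∈ B, ¬ WedgePos o α (ψ y) → y ∈ Z := by
    intro y hy h
    rw [(hσ y (hBK hy)).wedgePos_iff α hα, hψr y (hBK hy)] at h
    exact ⟨hy, not_lt.1 h⟩
  have hZp : ∀ y ∈ Z, 0 < σ * linDensity A (formInChart β₁ x₀) y := by
    intro y hy
    have hyK := hBK hy.1
    have := hβ₁pos (ψ y) ⟨y, hy.1, rfl⟩ (by
      rw [(hσ y hyK).wedgePos_iff α hα, hψr y hyK]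
      exact not_lt.2 hy.2)
    rwa [(hσ y hyK).linPos_iff α β₁ hα hβ₁.1, hψr y hyK] at this
  obtain ⟨N, hN⟩ := hZc.exists_bound_of_continuousOn
    (f := fun y => (σ * linDensity A (formInChart β₀ x₀) y) /
      (σ * linDensity A (formInChart β₁ x₀) y)) (by
    intro y hy
    have hyt := hKt (hBK hy.1)
    exact ((continuousAt_const.mul (hα.continuousAt_linDensity hs₀ hyt)).div
      (continuousAt_const.mul (hα.continuousAt_linDensity hβ₁.1 hyt))
      (hZp y hy).ne').continuousWithinAt)
  -- If `Z` is empty the bound `N` may be negative, hence the absolute value.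
  set R : ℝ := |N| + 1 with hR
  have hR0 : 0 ≤ R := by positivity
  have hsm : IsSmoothForm (R • β₁) := hβ₁.1.smul R
  refine ⟨β₀ + R • β₁, ⟨hs₀.add hsm, fun x hx => ?_⟩, fun hx => ?_⟩
  · by_cases hxK : x ∈ ψ '' K
    · obtain ⟨y, hyK, rfl⟩ := hxK
      by_cases hyB : y ∈ B
      · have hyZ := hZw y hyB hx
        have h1 := hZp y hyZ
        have h2 := neg_le_of_abs_le (hN y hyZ)
        rw [le_div_iff₀ h1] at h2
        have hsg := hσ y hyK
        rw [hsg.linNonneg_iff _ _ hα (hs₀.add hsm), formInChart_add, formInChart_smul,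
          linDensity_add (hs₀.differentiableAt hsg.mem_source)
            ((hβ₁.1.differentiableAt hsg.mem_source).const_smul R), linDensity_smul, hψr y hyK]
        have h3 : N ≤ |N| := le_abs_self N
        nlinarith [mul_nonneg (sub_nonneg.2 h3) h1.le]
      · refine linNonneg_add hα hs₀ hsm ?_ (linNonneg_smul hα hβ₁.1 (hβ₁.2 _ hx) hR0)
        rw [(hσ y hyK).linNonneg_iff _ _ hα hs₀, hψr y hyK]
        rw [← hA, hlin₀ y hyK]
        exact hnonneg y hyK hyB
    · exact linNonneg_add hα hs₀ hsm (linNonneg_of_eventually_zero o hα hs₀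
        (bumpForm_eventually_eq_zero c hK hKt hFK hxK)) (linNonneg_smul hα hβ₁.1 (hβ₁.2 x hx) hR0)
  · refine linPos_add hα hs₀ hsm ?_ (linNonneg_smul hα hβ₁.1 (hβ₁.2 _ hx) hR0)
    rw [(hσ p hpK).linPos_iff _ _ hα hs₀, hψr p hpK]
    rw [← hA, hlin₀ p hpK]
    exact hp

end Local

/-! ### The barrier at a point touched by a ball of good points -/

section Barrier

/-- This holds for `u ≤ 0` too, where `expNegInvGlue` vanishes (with `0⁻¹ = 0`). -/
theorem hasDerivAt_expNegInvGlue (u : ℝ) :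
    HasDerivAt expNegInvGlue (u⁻¹ ^ 2 * expNegInvGlue u) u := by
  have h := expNegInvGlue.hasDerivAt_polynomial_eval_inv_mul 1 u
  simpa using h

theorem det3_smul_right (a b c : E3 →L[ℝ] ℝ) (t : ℝ) : det3 a b (t • c) = t * det3 a b c := by
  simp only [det3, smul_apply, smul_eq_mul]
  ring

theorem det3_smul_mid (a b c : E3 →L[ℝ] ℝ) (t : ℝ) : det3 a (t • b) c = t * det3 a b c := by
  simp only [det3, smul_apply, smul_eq_mul]
  ring

/-- A quadratic function which is positive at `p` and on a neighbourhood of `p` only slightly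
outside of the ball with centre `p + ν` through `p`. -/
noncomputable def quadBarrier (p ν : E3) (δ : ℝ) (y : E3) : ℝ :=
  inner ℝ ν (y - p) - ‖y - p‖ ^ 2 + δ

/-- The differential of `quadBarrier p ν δ`. -/
noncomputable def quadBarrierDeriv (p ν y : E3) : E3 →L[ℝ] ℝ :=
  innerSL ℝ ν - (2 : ℝ) • innerSL ℝ (y - p)

theorem hasFDerivAt_quadBarrier (p ν : E3) (δ : ℝ) (y : E3) :
    HasFDerivAt (quadBarrier p ν δ) (quadBarrierDeriv p ν y) y := by
  have h0 : HasFDerivAt (fun z : E3 => z - p) (ContinuousLinearMap.id ℝ E3) y :=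
    (hasFDerivAt_id y).sub_const p
  have h1 : HasFDerivAt (fun z : E3 => innerSL ℝ ν (z - p)) (innerSL ℝ ν) y := by
    exact ((innerSL ℝ ν).hasFDerivAt.comp y h0).congr_fderiv (ContinuousLinearMap.comp_id _)
  have h2 := h0.norm_sq
  refine ((h1.sub h2).add_const δ).congr_fderiv ?_
  ext v
  simp [quadBarrierDeriv]

theorem contDiff_quadBarrier (p ν : E3) (δ : ℝ) : ContDiff ℝ ∞ (quadBarrier p ν δ) := by
  unfold quadBarrier
  exact ((contDiff_const.inner ℝ (contDiff_id.sub contDiff_const)).sub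
    ((contDiff_id.sub contDiff_const).norm_sq ℝ)).add contDiff_const

theorem continuousAt_det3 {a b : E3 → E3 →L[ℝ] ℝ} {y : E3} (ha : ContinuousAt a y)
    (hb : ContinuousAt b y) (c : E3 →L[ℝ] ℝ) : ContinuousAt (fun z => det3 (a z) (b z) c) y := by
  have h1 : ∀ v, ContinuousAt (fun z => a z v) y := fun v => ha.clm_apply continuousAt_const
  have h2 : ∀ v, ContinuousAt (fun z => b z v) y := fun v => hb.clm_apply continuousAt_const
  unfold det3
  exact (((h1 _).mul (((h2 _).mul continuousAt_const).sub ((h2 _).mul continuousAt_const))).sub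
    ((h1 _).mul (((h2 _).mul continuousAt_const).sub ((h2 _).mul continuousAt_const)))).add
    ((h1 _).mul (((h2 _).mul continuousAt_const).sub ((h2 _).mul continuousAt_const)))

/-- The exponential factors out, and for small `g > 0` the coefficient `g⁻²` makes the
transversality term `A ∧ g' ∧ c` outweigh the bounded first term. -/
theorem linDensity_expNegInvGlue_comp {A : E3 → E3 →L[ℝ] ℝ} {g : E3 → ℝ} {g' : E3 →L[ℝ] ℝ} {y : E3}
    (hg : HasFDerivAt g g' y) (c : E3 →L[ℝ] ℝ) :
    linDensity A (fun z => expNegInvGlue (g z) • c) y =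
      expNegInvGlue (g y) * (density (fun _ => c) A y + (g y)⁻¹ ^ 2 * det3 (A y) g' c) := by
  have h : HasFDerivAt (fun z => expNegInvGlue (g z)) (((g y)⁻¹ ^ 2 * expNegInvGlue (g y)) • g') y :=
    (hasDerivAt_expNegInvGlue (g y)).comp_hasFDerivAt y hg
  rw [linDensity_smul_const h.differentiableAt, h.fderiv, det3_smul_mid]
  ring

variable {M : Type*} [TopologicalSpace M] [T2Space M] [ChartedSpace E3 M] [IsManifold (𝓡 3) ∞ M]

/-- If, in a chart, a ball consists of good points and `p` is a point of its boundary which is not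
good, then the normal of the ball at `p` is proportional to `α`. -/
theorem det3_eq_zero_of_notMem_goodSet {o : ManifoldOrientation M} {α : OneForm M}
    (hα : IsSmoothForm α) {x₀ : M} {σ : ℝ} (hσ0 : σ ≠ 0) {W : Set E3} (hW : IsOpen W)
    (hWt : W ⊆ (extChartAt (𝓡 3) x₀).target)
    (hσ : ∀ y ∈ W, IsChartSign o x₀ σ ((extChartAt (𝓡 3) x₀).symm y)) {p q : E3} (hpW : p ∈ W)
    (hp : (extChartAt (𝓡 3) x₀).symm p ∉ goodSet o α)
    (hball : ∀ y ∈ W, dist y q < dist p q → (extChartAt (𝓡 3) x₀).symm y ∈ goodSet o α)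
    (c : E3 →L[ℝ] ℝ) : det3 (formInChart α x₀ p) (innerSL ℝ (q - p)) c = 0 := by
  by_contra hne
  refine hp ?_
  set ν := q - p with hν
  set A := formInChart α x₀ with hA
  -- Scaling `c` by the nonzero value itself replaces that value by its square.
  obtain ⟨c, hc⟩ : ∃ c, 0 < σ * det3 (A p) (innerSL ℝ ν) c := by
    refine ⟨(σ * det3 (A p) (innerSL ℝ ν) c) • c, ?_⟩
    rw [det3_smul_right]
    have h1 : σ * det3 (A p) (innerSL ℝ ν) c ≠ 0 := mul_ne_zero hσ0 hne
    have h2 := pow_pos (abs_pos.2 h1) 2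
    rw [sq_abs] at h2
    linarith
  set G : E3 → ℝ := fun y => σ * det3 (A y) (quadBarrierDeriv p ν y) c with hG
  set H : E3 → ℝ := fun y => σ * density (fun _ => c) A y with hH
  have hGp : 0 < G p := by simpa [hG, quadBarrierDeriv] using hc
  have hGc : ContinuousAt G p := by
    refine continuousAt_const.mul (continuousAt_det3 (hα.contDiffAt (hWt hpW)).continuousAt ?_ c)
    unfold quadBarrierDeriv
    exact Continuous.continuousAt (by fun_prop)
  have hHc : ContinuousAt H p := continuousAt_const.mul
    (Confoliation.continuousAt_density contDiffAt_const ((hα.contDiffAt (hWt hpW)).of_le (by simp)))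
  set m := G p / 2 with hm
  set b := |H p| + 1 with hb
  have hm0 : 0 < m := half_pos hGp
  have hb0 : 0 < b := by positivity
  have hev : ∀ᶠ y in 𝓝 p, y ∈ W ∧ m < G y ∧ |H y| < b :=
    Filter.Eventually.and (hW.mem_nhds hpW) ((hGc.eventually (lt_mem_nhds (half_lt_self hGp))).and
      (hHc.abs.eventually (gt_mem_nhds (lt_add_one _))))
  obtain ⟨r, hr, hrW⟩ := Metric.nhds_basis_closedBall.eventually_iff.1 hev
  -- For `ρ ≤ 1` the number `(‖ν‖ + 1) * ρ` bounds `g` on the ball of radius `ρ`; the inequality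
  -- then gives `g⁻² G > b > |H|` where `g > 0`.
  have hsmall : ∀ᶠ ρ : ℝ in 𝓝[>] 0, ((‖ν‖ + 1) * ρ) ^ 2 * b < m := by
    have : ContinuousAt (fun ρ : ℝ => ((‖ν‖ + 1) * ρ) ^ 2 * b) 0 :=
      Continuous.continuousAt (by fun_prop)
    exact (this.eventually (gt_mem_nhds (by simpa using hm0))).filter_mono nhdsWithin_le_nhds
  obtain ⟨ρ, hρb, hρ⟩ := (hsmall.and (Ioc_mem_nhdsGT (lt_min hr one_pos))).exists
  have hρ0 : 0 < ρ := hρ.1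
  have hρ1 : ρ ≤ 1 := hρ.2.trans (min_le_right _ _)
  have hρW : ∀ y ∈ Metric.closedBall p ρ, y ∈ W ∧ m < G y ∧ |H y| < b := fun y hy =>
    hrW (Metric.closedBall_subset_closedBall (hρ.2.trans (min_le_left _ _)) hy)
  set δ := ρ ^ 2 / 16 with hδ
  have hδ0 : 0 < δ := by positivity
  set g := quadBarrier p ν δ with hg
  have hgc : Continuous g := (contDiff_quadBarrier p ν δ).continuous
  let χ : ContDiffBump p := ⟨ρ / 2, ρ, half_pos hρ0, half_lt_self hρ0⟩
  set F : E3 → ℝ := fun y => χ y * expNegInvGlue (g y) with hF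
  have hFs : ContDiff ℝ ∞ F := χ.contDiff.mul (expNegInvGlue.contDiff.comp (contDiff_quadBarrier p ν δ))
  set K := Metric.closedBall p ρ with hK
  -- The only region where the derivative of the cutoff `χ` can spoil the sign.
  set B := K ∩ ({y | ρ / 2 ≤ dist y p} ∩ {y | 0 ≤ g y}) with hB
  have hKc : IsCompact K := isCompact_closedBall p ρ
  have hBc : IsCompact B := hKc.inter_right
    ((isClosed_le continuous_const (by fun_prop)).inter (isClosed_le continuous_const hgc))
  have hBg : ∀ y ∈ B, (extChartAt (𝓡 3) x₀).symm y ∈ goodSet o α := by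
    rintro y ⟨hyK, hyp, hyg⟩
    refine hball y (hρW y hyK).1 ?_
    simp only [mem_ofPred_eq, dist_eq_norm] at hyp
    -- With `g y ≥ 0` this is at most `‖ν‖² - ‖y - p‖² + 2δ`. Since `2δ = ρ²/8 < (ρ/2)²`, the point
    -- lies strictly inside the ball of good points.
    have h1 : ‖y - q‖ ^ 2 = ‖y - p‖ ^ 2 - 2 * inner ℝ ν (y - p) + ‖ν‖ ^ 2 := by
      have : y - q = (y - p) - ν := by rw [hν]; abel
      rw [this, norm_sub_sq_real, real_inner_comm]
    have h2 : 0 ≤ inner ℝ ν (y - p) - ‖y - p‖ ^ 2 + δ := hyg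
    have h3 : (ρ / 2) ^ 2 ≤ ‖y - p‖ ^ 2 := pow_le_pow_left₀ (half_pos hρ0).le hyp 2
    have h4 : ‖p - q‖ = ‖ν‖ := by rw [norm_sub_rev]
    rw [dist_eq_norm, dist_eq_norm, h4]
    refine lt_of_pow_lt_pow_left₀ 2 (norm_nonneg _) ?_
    have h5 : 0 < ρ ^ 2 := by positivity
    rw [h1]
    linarith
  have hinner : ∀ y ∈ K, dist y p < ρ / 2 →
      σ * linDensity A (fun z => F z • c) y =
        expNegInvGlue (g y) * (H y + (g y)⁻¹ ^ 2 * G y) := by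
    intro y hyK hyp
    have h1 : (fun z => F z • c) =ᶠ[𝓝 y] fun z => expNegInvGlue (g z) • c := by
      filter_upwards [Metric.isOpen_ball.mem_nhds (show y ∈ Metric.ball p (ρ / 2) from hyp)] with z hz
      have : χ z = 1 := χ.one_of_mem_closedBall (Metric.ball_subset_closedBall hz)
      simp only [hF, this, one_mul]
    rw [linDensity_congr h1, linDensity_expNegInvGlue_comp (hasFDerivAt_quadBarrier p ν δ y)]
    simp only [hG, hH, hg]
    ring
  have hfac : ∀ y ∈ K, 0 < g y → 0 < H y + (g y)⁻¹ ^ 2 * G y := by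
    intro y hyK hgy
    obtain ⟨-, h1, h2⟩ := hρW y hyK
    have h3 : g y ≤ (‖ν‖ + 1) * ρ := by
      have h4 : inner ℝ ν (y - p) ≤ ‖ν‖ * ρ := (real_inner_le_norm _ _).trans
        (mul_le_mul_of_nonneg_left (by rwa [← dist_eq_norm]) (norm_nonneg _))
      have h5 : ρ ^ 2 ≤ ρ := by nlinarith
      have h6 : g y = inner ℝ ν (y - p) - ‖y - p‖ ^ 2 + ρ ^ 2 / 16 := rfl
      nlinarith [sq_nonneg ‖y - p‖]
    have h4 : g y ^ 2 * b < G y :=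
      ((mul_le_mul_of_nonneg_right (pow_le_pow_left₀ hgy.le h3 2) hb0.le).trans_lt hρb).trans h1
    have h5 : b < (g y)⁻¹ ^ 2 * G y := by
      rw [inv_pow, ← div_eq_inv_mul, lt_div_iff₀ (by positivity)]
      linarith
    linarith [neg_abs_le (H y)]
  have hgp : g p = δ := by simp [hg, quadBarrier]
  refine mem_goodSet_of_chart hα (x₀ := x₀) (σ := σ) hKc hBc inter_subset_left
    (fun y hy => hWt (hρW y hy).1) (fun y hy => hσ y (hρW y hy).1) hBg hFs ?_ c ?_
    (Metric.mem_closedBall_self hρ0.le) ?_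
  · intro y hy
    have : χ y = 0 := χ.zero_of_le_dist (not_le.1 hy).le
    simp only [hF, this, zero_mul]
  · intro y hyK hyB
    by_cases hyp : dist y p < ρ / 2
    · rw [hinner y hyK hyp]
      rcases le_or_gt (g y) 0 with h | h
      · rw [expNegInvGlue.zero_of_nonpos h, zero_mul]
      · exact mul_nonneg (expNegInvGlue.nonneg _) (hfac y hyK h).le
    · have hgy : g y < 0 := by
        by_contra h
        exact hyB ⟨hyK, not_lt.1 hyp, not_lt.1 h⟩
      -- Strict negativity of `g` persists near `y`, so `F` vanishes there together with its
      -- derivative.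
      have h1 : (fun z => F z • c) =ᶠ[𝓝 y] 0 := by
        filter_upwards [hgc.continuousAt.eventually (gt_mem_nhds hgy)] with z hz
        simp [hF, expNegInvGlue.zero_of_nonpos (le_of_lt hz)]
      rw [linDensity_congr h1, linDensity_zero, mul_zero]
  · rw [hinner p (Metric.mem_closedBall_self hρ0.le) (by simpa using hρ0)]
    exact mul_pos (expNegInvGlue.pos_of_pos (hgp ▸ hδ0))
      (hfac p (Metric.mem_closedBall_self hρ0.le) (hgp ▸ hδ0))

end Barrier

/-! ### Propagation of bad points along tangent paths -/

section Paths

/-- The hypothesis says that `a ∧ b = 0`, tested on the three coordinate covectors; the conclusion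
evaluates `a ∧ b` on `w` and `z`. -/
theorem mul_eq_mul_of_det3_eq_zero {a b : E3 →L[ℝ] ℝ} (h : ∀ c, det3 a b c = 0) (w z : E3) :
    a w * b z = a z * b w := by
  have hexp : ∀ (a : E3 →L[ℝ] ℝ) (u : E3),
      a u = u 0 * a (stdBasis 0) + u 1 * a (stdBasis 1) + u 2 * a (stdBasis 2) := by
    intro a u
    conv_lhs => rw [eq_sum_stdBasis u]
    simp
  have h0 := h (EuclideanSpace.proj 0)
  have h1 := h (EuclideanSpace.proj 1)
  have h2 := h (EuclideanSpace.proj 2)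
  simp [det3, stdBasis] at h0 h1 h2
  rw [hexp a w, hexp a z, hexp b w, hexp b z]
  simp only [stdBasis, OrthonormalBasis.coe_toBasis, EuclideanSpace.basisFun_apply]
  linear_combination (w 1 * z 2 - w 2 * z 1) * h0 - (w 0 * z 2 - w 2 * z 0) * h1
    + (w 0 * z 1 - w 1 * z 0) * h2

/-- A curve which starts on the compact set `C` stays on it, if its velocity is almost
perpendicular to the normals to `C`. -/
theorem mem_of_inner_normal_le {u v : ℝ → E3} {C : Set E3} (hC : IsCompact C) {a b k : ℝ}
    (hu : ContinuousOn u (Icc a b)) (hv : ∀ t ∈ Ico a b, HasDerivWithinAt u (v t) (Ici t) t)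
    (ha : u a ∈ C)
    (hn : ∀ t ∈ Ico a b, ∀ c ∈ C, Metric.infDist (u t) C = dist (u t) c →
      2 * inner ℝ (u t - c) (v t) ≤ k * ‖u t - c‖ ^ 2) :
    ∀ t ∈ Icc a b, u t ∈ C := by
  set F : ℝ → ℝ := fun t => Metric.infDist (u t) C ^ 2 with hF
  have hFc : ContinuousOn F (Icc a b) := ((Metric.continuous_infDist_pt C).comp_continuousOn hu).pow 2
  have key := le_gronwallBound_of_liminf_deriv_right_le (f := F) (f' := fun t => k * F t) (δ := 0)
    (K := k) (ε := 0) hFc ?_ (by simp [hF, Metric.infDist_zero_of_mem ha]) (fun t _ => by simp)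
  · intro t ht
    have h1 := key t ht
    rw [gronwallBound_ε0_δ0] at h1
    have h2 : Metric.infDist (u t) C = 0 := by
      have : Metric.infDist (u t) C ^ 2 = 0 := le_antisymm h1 (sq_nonneg _)
      simpa using this
    rwa [hC.isClosed.mem_iff_infDist_zero ⟨_, ha⟩]
  · intro t ht r hr
    -- The squared distance need not be differentiable. With `c` frozen, `‖u z - c‖²` is
    -- differentiable from the right at `z = t`, dominates it, and agrees with it there, so it
    -- bounds the lower right slope.
    obtain ⟨c, hc, hdc⟩ := hC.exists_infDist_eq_dist ⟨_, ha⟩ (u t)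
    have hE : HasDerivWithinAt (fun z => ‖u z - c‖ ^ 2) (2 * inner ℝ (u t - c) (v t)) (Ici t) t :=
      ((hv t ht).sub_const c).norm_sq
    have h1 : 2 * inner ℝ (u t - c) (v t) < r := by
      refine (hn t ht c hc hdc).trans_lt ?_
      rwa [← dist_eq_norm, ← hdc]
    refine ((hE.liminf_right_slope_le h1).and_eventually self_mem_nhdsWithin).mono ?_
    rintro z ⟨hz, hzt⟩
    refine lt_of_le_of_lt ?_ hz
    rw [slope_def_field, div_eq_inv_mul]
    have hzt' : 0 < z - t := sub_pos.2 hzt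
    refine mul_le_mul_of_nonneg_left ?_ (inv_nonneg.2 hzt'.le)
    have h2 : F t = ‖u t - c‖ ^ 2 := by rw [hF, ← dist_eq_norm, ← hdc]
    have h3 : F z ≤ ‖u z - c‖ ^ 2 := by
      rw [← dist_eq_norm]
      exact pow_le_pow_left₀ Metric.infDist_nonneg (Metric.infDist_le_dist_of_mem hc) 2
    linarith

variable {M : Type*} [TopologicalSpace M] [ChartedSpace E3 M] [IsManifold (𝓡 3) ∞ M]

/-- The velocity, in the chart at `x₀`, of a tangent path. -/
theorem IsTangentPath.exists_chart_velocity {ξ : PlaneField M} {α : OneForm M}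
    (hα : IsDefiningForm ξ α) {γ : ℝ → M} (hγ : IsTangentPath ξ γ) {t₀ : ℝ}
    (ht₀ : t₀ ∈ Ico (0 : ℝ) 1) {U : Set M} (hU : U ∈ 𝓝 (γ t₀)) :
    ∃ t₁ ∈ Ioc t₀ 1, ∃ (v : ℝ → E3) (V : ℝ),
      (∀ t ∈ Icc t₀ t₁, γ t ∈ U ∧ γ t ∈ (chartAt E3 (γ t₀)).source) ∧
      ContinuousOn (fun t => extChartAt (𝓡 3) (γ t₀) (γ t)) (Icc t₀ t₁) ∧
      ∀ t ∈ Ico t₀ t₁,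
        HasDerivWithinAt (fun t => extChartAt (𝓡 3) (γ t₀) (γ t)) (v t) (Ici t) t ∧
        ‖v t‖ ≤ V ∧ formInChart α (γ t₀) (extChartAt (𝓡 3) (γ t₀) (γ t)) (v t) = 0 := by
  set x₀ := γ t₀ with hx₀
  have hI : t₀ ∈ Icc (0 : ℝ) 1 := Ico_subset_Icc_self ht₀
  have hs : (chartAt E3 x₀).source ∈ 𝓝 (γ t₀) :=
    (chartAt E3 x₀).open_source.mem_nhds (mem_chart_source E3 x₀)
  have h1 : ∀ᶠ t in 𝓝[≥] t₀, γ t ∈ U ∧ γ t ∈ (chartAt E3 x₀).source := by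
    have hc : ContinuousWithinAt γ (Ici t₀) t₀ :=
      (hγ.1.continuousOn t₀ hI).mono_of_mem_nhdsWithin
        (mem_of_superset (Icc_mem_nhdsGE ht₀.2) (Icc_subset_Icc_left ht₀.1))
    exact hc.eventually (inter_mem hU hs)
  obtain ⟨t₂, ht₂, hsub₂⟩ := mem_nhdsGE_iff_exists_Icc_subset.1 h1
  obtain ⟨t₁, ht₁, hsub⟩ : ∃ t₁ ∈ Ioc t₀ 1, ∀ t ∈ Icc t₀ t₁, γ t ∈ U ∧
      γ t ∈ (chartAt E3 x₀).source :=
    ⟨min t₂ 1, ⟨lt_min ht₂ ht₀.2, min_le_right _ _⟩,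
      fun t ht => hsub₂ ⟨ht.1, ht.2.trans (min_le_left _ _)⟩⟩
  have hJ : Icc t₀ t₁ ⊆ Icc 0 1 := Icc_subset_Icc ht₀.1 ht₁.2
  set u : ℝ → E3 := fun t => extChartAt (𝓡 3) x₀ (γ t) with hu
  have hud : ContDiffOn ℝ 1 u (Icc t₀ t₁) := by
    rw [← contMDiffOn_iff_contDiffOn]
    intro t ht
    exact ((contMDiffAt_extChartAt' (I := 𝓡 3) (n := 1) (hsub t ht).2).comp_contMDiffWithinAt t
      ((hγ.1 t (hJ ht)).mono hJ))
  set v : ℝ → E3 := fun t => chartDeriv x₀ (γ t)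
    (mfderivWithin 𝓘(ℝ, ℝ) (𝓡 3) γ (Icc 0 1) t (1 : ℝ)) with hv
  have hder : ∀ t ∈ Icc t₀ t₁, HasDerivWithinAt u (v t) (Icc t₀ t₁) t := by
    intro t ht
    have h2 : HasMFDerivWithinAt 𝓘(ℝ, ℝ) (𝓡 3) γ (Icc 0 1) t
        (mfderivWithin 𝓘(ℝ, ℝ) (𝓡 3) γ (Icc 0 1) t) :=
      ((hγ.1 t (hJ ht)).mdifferentiableWithinAt (by simp)).hasMFDerivWithinAt
    have h3 : HasMFDerivAt (𝓡 3) 𝓘(ℝ, E3) (extChartAt (𝓡 3) x₀) (γ t)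
        (mfderiv (𝓡 3) 𝓘(ℝ, E3) (extChartAt (𝓡 3) x₀) (γ t)) :=
      (mdifferentiableAt_extChartAt (hsub t ht).2).hasMFDerivAt
    have h4 := (h3.comp_hasMFDerivWithinAt t h2).mono hJ
    have h5 : HasFDerivWithinAt u ((chartDeriv x₀ (γ t)).comp
        (mfderivWithin 𝓘(ℝ, ℝ) (𝓡 3) γ (Icc 0 1) t : ℝ →L[ℝ] E3)) (Icc t₀ t₁) t :=
      h4.hasFDerivWithinAt
    exact h5.hasDerivWithinAt
  -- The `C^1` hypothesis is used here: a continuous velocity is bounded on the compact interval.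
  have hvc : ContinuousOn v (Icc t₀ t₁) := by
    refine (hud.continuousOn_derivWithin (uniqueDiffOn_Icc ht₁.1) le_rfl).congr fun t ht => ?_
    exact ((hder t ht).derivWithin (uniqueDiffOn_Icc ht₁.1 t ht)).symm
  obtain ⟨V, hV⟩ := isCompact_Icc.exists_bound_of_continuousOn hvc
  refine ⟨t₁, ht₁, v, V, hsub, hud.continuousOn, fun t ht => ?_⟩
  have htI := Ico_subset_Icc_self ht
  refine ⟨(hder t htI).mono_of_mem_nhdsWithin
    (mem_of_superset (Icc_mem_nhdsGE ht.2) (Icc_subset_Icc_left ht.1)), hV t htI, ?_⟩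
  refine (formInChart_chartDeriv α (hsub t htI).2 _).trans ?_
  exact ((hα.2 _).2 _).1 (hγ.2 t (hJ htI))

variable [T2Space M]

/-- At a nearest bad point `c` to `y = φ (γ t)`, the normal `y - c` is proportional to `α` at `c`.
The velocity is killed by `α` at `y`, hence almost killed at `c` because `α` is Lipschitz in the
chart. -/
theorem IsTangentPath.eventually_notMem_goodSet {o : ManifoldOrientation M} {ξ : PlaneField M}
    {α : OneForm M} (hα : IsDefiningForm ξ α) {γ : ℝ → M} (hγ : IsTangentPath ξ γ) {t₀ : ℝ}
    (ht₀ : t₀ ∈ Ico (0 : ℝ) 1) (hbad : γ t₀ ∉ goodSet o α) :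
    ∀ᶠ t in 𝓝[>] t₀, γ t ∉ goodSet o α := by
  set x₀ := γ t₀ with hx₀
  set φ := extChartAt (𝓡 3) x₀ with hφ
  set A := formInChart α x₀ with hA
  have hxs : x₀ ∈ (chartAt E3 x₀).source := mem_chart_source E3 x₀
  have hyt : φ x₀ ∈ φ.target := mem_extChartAt_target x₀
  have hAd : ContDiffAt ℝ 1 A (φ x₀) := (hα.1.contDiffAt hyt).of_le (by simp)
  obtain ⟨σ, hσ0, hσ⟩ := exists_isChartSign o x₀
  obtain ⟨Λ, T, hT, hΛ⟩ := hAd.exists_lipschitzOnWith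
  obtain ⟨w, hw⟩ : ∃ w, A (φ x₀) w ≠ 0 := by
    by_contra! h
    refine (hα.2 x₀).1 (ContinuousLinearMap.ext fun u => ?_)
    rw [← formInChart_chartDeriv α hxs u]
    exact h _
  set μ := |A (φ x₀) w| / 2 with hμ
  have hμ0 : 0 < μ := half_pos (abs_pos.2 hw)
  have hev : ∀ᶠ y in 𝓝 (φ x₀), y ∈ φ.target ∧ IsChartSign o x₀ σ (φ.symm y) ∧ y ∈ T ∧
      μ < |A y w| := by
    refine Filter.Eventually.and (extChartAt_target_mem_nhds (I := 𝓡 3) x₀)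
      (Filter.Eventually.and ?_ (Filter.Eventually.and hT ?_))
    · have hc := continuousAt_extChartAt_symm (I := 𝓡 3) x₀
      refine hc.eventually ?_
      rwa [extChartAt_to_inv]
    · exact ((hAd.continuousAt.clm_apply continuousAt_const).abs).eventually
        (lt_mem_nhds (half_lt_self (abs_pos.2 hw)))
  obtain ⟨r, hr, hrW⟩ := Metric.nhds_basis_closedBall.eventually_iff.1 hev
  set W := Metric.ball (φ x₀) r with hW
  have hWr : ∀ y ∈ W, y ∈ Metric.closedBall (φ x₀) r := fun y hy => Metric.ball_subset_closedBall hy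
  -- Since the centre is itself bad, keeping the path within `r / 2` of it forces nearest bad points
  -- into the open ball `W` of radius `r`.
  have hU : φ ⁻¹' Metric.ball (φ x₀) (r / 2) ∈ 𝓝 (γ t₀) :=
    (continuousAt_extChartAt x₀).preimage_mem_nhds (Metric.ball_mem_nhds _ (half_pos hr))
  obtain ⟨t₁, ht₁, v, V, hγU, huc, hder⟩ := hγ.exists_chart_velocity hα ht₀ hU
  set C := Metric.closedBall (φ x₀) r ∩ φ.symm ⁻¹' (goodSet o α)ᶜ with hC
  have hCc : IsCompact C := by
    refine (isCompact_closedBall (φ x₀) r).of_isClosed_subset ?_ inter_subset_left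
    refine ContinuousOn.preimage_isClosed_of_isClosed ?_ Metric.isClosed_closedBall
      (isOpen_goodSet o hα.1).isClosed_compl
    exact (continuousOn_extChartAt_symm x₀).mono fun y hy => (hrW hy).1
  have hx₀C : φ (γ t₀) ∈ C := by
    refine ⟨Metric.mem_closedBall_self hr.le, ?_⟩
    change φ.symm (φ x₀) ∉ _
    rwa [hφ, extChartAt_to_inv]
  have hmem := mem_of_inner_normal_le (u := fun t => φ (γ t)) (v := v) (k := 2 * (Λ * V * ‖w‖ / μ))
    hCc huc (fun t ht => (hder t ht).1) hx₀C ?_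
  · filter_upwards [Ioc_mem_nhdsGT ht₁.1] with t ht
    have h1 := (hmem t (Ioc_subset_Icc_self ht)).2
    have h2 : φ.symm (φ (γ t)) = γ t :=
      φ.left_inv (by simpa [hφ] using (hγU t (Ioc_subset_Icc_self ht)).2)
    change φ.symm (φ (γ t)) ∉ _ at h1
    rwa [h2] at h1
  · intro t ht c hc hdc
    obtain ⟨-, hvV, hAv⟩ := hder t ht
    have htI := Ico_subset_Icc_self ht
    set y := φ (γ t) with hy
    have hyr : dist y (φ x₀) < r / 2 := (hγU t htI).1
    have hyW : y ∈ Metric.closedBall (φ x₀) r := by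
      rw [Metric.mem_closedBall]; linarith
    have hcW : c ∈ W := by
      have h1 : dist y c ≤ dist y (φ x₀) := hdc ▸ Metric.infDist_le_dist_of_mem hx₀C
      have h2 := dist_triangle_left c (φ x₀) y
      rw [hW, Metric.mem_ball]
      linarith
    -- The touching ball is centred at `y` and passes through `c`: any point of `W` closer to `y`
    -- than `c` is good, because `c` is nearest in `C`.
    have hdet := det3_eq_zero_of_notMem_goodSet hα.1 hσ0 (W := W) Metric.isOpen_ball
      (fun z hz => (hrW (hWr z hz)).1) (fun z hz => (hrW (hWr z hz)).2.1) hcW (q := y) hc.2 (by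
        intro z hz hzd
        by_contra hzb
        have : Metric.infDist y C ≤ dist y z := Metric.infDist_le_dist_of_mem ⟨hWr z hz, hzb⟩
        rw [hdc, dist_comm y c, dist_comm y z] at this
        linarith)
    -- The fixed vector `w` is transverse to `ker A` throughout the chart ball. Dividing by `A c w`,
    -- which exceeds `μ` in absolute value, makes `inner ℝ ν (v t)` of order `‖ν‖²`: one factor
    -- comes from `A c (v t)`, one from `inner ℝ ν w`.
    have hprop := mul_eq_mul_of_det3_eq_zero hdet w (v t)
    simp only [innerSL_apply_apply] at hprop
    set ν := y - c with hν
    have h1 : |A c (v t)| ≤ Λ * ‖ν‖ * V := by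
      have h2 : A c (v t) = (A c - A y) (v t) := by
        rw [sub_apply, hAv, sub_zero]
      have h3 : ‖A c - A y‖ ≤ Λ * ‖ν‖ := by
        have := hΛ.dist_le_mul c (hrW (hWr c hcW)).2.2.1 y (hrW hyW).2.2.1
        rwa [dist_eq_norm, dist_eq_norm, ← norm_sub_rev y c] at this
      rw [h2, ← Real.norm_eq_abs]
      exact ((A c - A y).le_opNorm (v t)).trans
        (mul_le_mul h3 hvV (norm_nonneg _) (by positivity))
    have h2 : |inner ℝ ν w| ≤ ‖ν‖ * ‖w‖ := abs_real_inner_le_norm ν w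
    have h3 : μ * |inner ℝ ν (v t)| ≤ (Λ * ‖ν‖ * V) * (‖ν‖ * ‖w‖) := by
      calc μ * |inner ℝ ν (v t)| ≤ |A c w| * |inner ℝ ν (v t)| :=
            mul_le_mul_of_nonneg_right (hrW (hWr c hcW)).2.2.2.le (abs_nonneg _)
        _ = |A c (v t)| * |inner ℝ ν w| := by rw [← abs_mul, ← abs_mul, hprop]
        _ ≤ _ := mul_le_mul h1 h2 (abs_nonneg _) ((abs_nonneg _).trans h1)
    have h4 : |inner ℝ ν (v t)| ≤ Λ * V * ‖w‖ / μ * ‖ν‖ ^ 2 := by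
      rw [div_mul_eq_mul_div, le_div_iff₀ hμ0]
      linarith
    linarith [le_abs_self (inner ℝ ν (v t))]

theorem goodSet_eq_univ {o : ManifoldOrientation M} {ξ : PlaneField M} {α : OneForm M}
    (hα : IsDefiningForm ξ α) (hG : accessibleSet o ξ = univ) (x : M) : x ∈ goodSet o α := by
  by_contra hx
  obtain ⟨γ, hγ, rfl, h1⟩ : x ∈ accessibleSet o ξ := hG ▸ mem_univ x
  have hclosed : IsClosed ({t | γ t ∉ goodSet o α} ∩ Icc 0 1) := by
    rw [inter_comm]
    exact hγ.1.continuousOn.preimage_isClosed_of_isClosed isClosed_Icc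
      (isOpen_goodSet o hα.1).isClosed_compl
  -- Continuous induction: the set of bad times is closed, contains `0`, and extends to the right of
  -- each of its points before `1`, so it contains `1`.
  have hsub := hclosed.Icc_subset_of_forall_mem_nhdsWithin hx fun t ht =>
    hγ.eventually_notMem_goodSet hα ht.2 ht.1
  exact hsub (right_mem_Icc.2 zero_le_one)
    (mem_goodSet_of_wedgePos hα.1 (wedgePos_of_mem_hotZone hα h1))

end Paths

end Confoliation

theorem mainTheorem6 {M : Type*} [TopologicalSpace M] [T2Space M] [CompactSpace M]
    [ChartedSpace (EuclideanSpace ℝ (Fin 3)) M] [IsManifold (𝓡 3) ∞ M]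
    (o : Confoliation.ManifoldOrientation M) (ξ : Confoliation.PlaneField M)
    (hξ : Confoliation.IsConfoliation o ξ)
    (hG : Confoliation.accessibleSet o ξ = Set.univ) :
    Confoliation.CanBeDeformedToContact o ξ := by
  obtain ⟨α, hα, hn⟩ := hξ
  obtain ⟨β, hβ, hpos⟩ := Confoliation.exists_admissible_of_isCompact (o := o) hα.1 isCompact_univ
    fun x _ => Confoliation.goodSet_eq_univ hα hG x
  exact Confoliation.canBeDeformedToContact_of_linPos hα hβ.1 hn fun x => hpos x (mem_univ x)
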